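/- For positive integers $q,k,\ell$ let $q\cdot(\mathbf 1_k\mathbf 0_\ell)$ be the $(k+\ell)\times q$ matrix consisting of $q$ copies of the column of $k$ ones above $\ell$ zeros. A $(0,1)$-matrix $A$ has a matrix $F$ as a configuration if some submatrix of $A$ is a row and column permutation of $F$; $A$ is simple if no column of it is repeated; and $\mathrm{forb}(m,F)$ is the maximum number of columns of a simple $m$-rowed $(0,1)$-matrix with no configuration $F$. A 2-design $S_\lambda(2,3,v)$ is a collection of $\frac{\lambda}{3}\binom v2$ triples from $\{1,\dots,v\}$, repetitions allowed, such that every pair of distinct points lies in exactly $\lambda$ of them. Let $q>2$ be an integer. There is a constant $M=M(q)$ such that for every $m>M$ the following holds. (a) If $A$ is an $m\times n$ $(0,1)$-matrix in which no column of sum $0$, $1$, $2$ or $m$ is repeated and which has no configuration $q\cdot(\mathbf 1_2\mathbf 0_1)$, then $$n\le m+2+\frac{q+1}{3}\binom m2 .$$ (b) If $m\equiv 1,3\pmod 6$, then equality is attained in (a) by some such $A$, and moreover $$\mathrm{forb}(m,q\cdot(\mathbf 1_2\mathbf 0_1))=m+2+\frac{q+1}{3}\binom m2 .$$ (c) If $m\equiv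 1,3\pmod 6$, then an $m\times n$ $(0,1)$-matrix $A$ satisfies the hypotheses of (a) and has exactly $n=\mathrm{forb}(m,q\cdot(\mathbf 1_2\mathbf 0_1))$ columns if and only if $A$ consists of all possible columns of sum $0,1,2,m$, once each, together with columns of sum $3$ that correspond to the triples of a 2-design $S_{q-2}(2,3,m)$, and has no further columns. -/

import Mathlib

namespace ForbConfig

/-- An `m × n` (0,1)-matrix. -/
abbrev ZOMatrix (m n : ℕ) : Type := Matrix (Fin m) (Fin n) (Fin 2)

/-- The `j`-th column of `A`. -/
def column {m n : ℕ} (A : ZOMatrix m n) (j : Fin n) : Fin m → Fin 2 := fun i => A i j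

/-- The sum of a (0,1)-column, as a natural number: its number of 1's. -/
def colSum {m : ℕ} (α : Fin m → Fin 2) : ℕ := ∑ i, (α i : ℕ)

/-- The set of rows in which the column `α` has a 1. -/
def supp {m : ℕ} (α : Fin m → Fin 2) : Finset (Fin m) := Finset.univ.filter fun i => α i = 1

/-- `A` has the configuration `F`: some submatrix of `A` is a row and column permutation of `F`. -/
def HasConfig {m n k l : ℕ} (A : ZOMatrix m n) (F : ZOMatrix k l) : Prop :=
  ∃ (r : Fin k ↪ Fin m) (c : Fin l ↪ Fin n), A.submatrix r c = F

/-- The matrix `q · (1_k 0_l)`: `q` copies of the column of `k` 1's above `l` 0's. -/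
def copies (q k l : ℕ) : ZOMatrix (k + l) q :=
  Matrix.of fun i _ => if (i : ℕ) < k then 1 else 0

/-- A (0,1)-matrix is simple if no column is repeated. -/
def IsSimple {m n : ℕ} (A : ZOMatrix m n) : Prop :=
  Function.Injective (column A)

/-- `forb(m, F)`: the smallest `N` such that every simple `m`-rowed matrix without
configuration `F` has at most `N` columns. -/
noncomputable def forb {k l : ℕ} (m : ℕ) (F : ZOMatrix k l) : ℕ :=
  sInf {N : ℕ | ∀ (n : ℕ) (A : ZOMatrix m n), IsSimple A → ¬ HasConfig A F → n ≤ N}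

/-- No column of sum 0, 1, 2 or `m` is repeated in the `m`-rowed matrix `A`. -/
def NoRepeatedSmallOrFull {m n : ℕ} (A : ZOMatrix m n) : Prop :=
  ∀ j j' : Fin n, colSum (column A j) ∈ ({0, 1, 2, m} : Set ℕ) →
    column A j = column A j' → j = j'

/-- A 2-design `S_lam(2,3,v)`: a multiset of `(lam/3) * C(v,2)` triples of points such that
every pair of distinct points lies in exactly `lam` of them (with multiplicity). -/
def IsTripleSystem (v lam : ℕ) (B : Multiset (Finset (Fin v))) : Prop :=
  (∀ b ∈ B, b.card = 3) ∧
  3 * B.card = lam * v.choose 2 ∧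
  ∀ i j : Fin v, i ≠ j → B.countP (fun b => i ∈ b ∧ j ∈ b) = lam

/-- The multiset of the triples that correspond to the columns of `A` of sum 3. -/
def triples {m n : ℕ} (A : ZOMatrix m n) : Multiset (Finset (Fin m)) :=
  (Finset.univ.filter fun j => colSum (column A j) = 3).val.map fun j => supp (column A j)

/-- `A` consists of all possible columns of sum 0, 1, 2, `m`, once each, together with
columns of sum 3 that correspond to the triples of a 2-design `S_lam(2,3,m)`, and of no
further columns. -/
def ConsistsOfDesign {m n : ℕ} (lam : ℕ) (A : ZOMatrix m n) : Prop :=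
  (∀ α : Fin m → Fin 2, colSum α ∈ ({0, 1, 2, m} : Set ℕ) → ∃! j, column A j = α) ∧
  IsTripleSystem m lam (triples A) ∧
  ∀ j, colSum (column A j) ∈ ({0, 1, 2, 3, m} : Set ℕ)

end ForbConfig

/-! Replace columns by their supports. Avoiding the configuration means that fewer than `q` members
contain a pair `p` and miss a point `k` outside it; equivalently, any `q` members through a pair
cover the ground set of `m` points. The sizes `0`, `1`, `m` contribute at most `m + 2` members.
Every other member spreads weight `1` evenly over its pairs, so the number of these members is the
total weight, and it suffices that the average weight of a pair is at most `(q+1)/3`.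

Call a member small if it has fewer than `m/q` points. Then `q` small members cannot cover, so a
pair lies in at most `q - 1` of them. At most one is the pair itself, with weight `1`; the others
give at most `1/3` each. Hence the small weight is at most `1 + (q-2)/3 = (q+1)/3`. A pair attaining
this is full, and any other pair falls short by at least `1/6` (`sum_smallThrough_le`).

Large proper members add only `O(1/m)` to each pair, hence `O(m)` in total. But a single large
member `c₀` missing `k` costs more: if `p` inside `c₀` is full, then `p`, its `q - 2` triples and
`c₀` are `q` members that must cover `k`, so `p` with `k` added is one of the triples. There are
`O(m)` triples through `k`, so all but `O(m)` of the quadratically many pairs of `c₀` lose `1/6`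
(`sum_pairWeight_lt_of_large`). Thus equality excludes large proper members and makes every pair
full, which is the design structure.

Attaining the bound by a simple matrix requires a design with distinct triples. It is the union of
`q - 2` pairwise disjoint Steiner triple systems, obtained by twisting the Bose and Skolem
constructions by shifts (`exists_simple_triple_design`). -/

namespace ForbConfig

/-! ### Set systems: weights on pairs and the contribution of small members. -/

section SetSystems

set_option linter.unusedSectionVars false

open Finset

variable {ι V : Type*} [Fintype ι] [DecidableEq ι] [Fintype V] [DecidableEq V]

/-- The members of the system `S` that contain `p`, other than the whole ground set. -/
def through (S : ι → Finset V) (p : Finset V) : Finset ι :=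
  univ.filter fun c => p ⊆ S c ∧ (S c).card < Fintype.card V

/-- Every pair `p` and point `k ∉ p` are separated by fewer than `q` members. -/
def FewSeparating (q : ℕ) (S : ι → Finset V) : Prop :=
  ∀ p : Finset V, p.card = 2 → ∀ k ∉ p, (univ.filter fun c => p ⊆ S c ∧ k ∉ S c).card < q

/-- Members with `0`, `1`, `2` or all of the points are not repeated. -/
def NoRepeats (S : ι → Finset V) : Prop :=
  ∀ c c', ((S c).card = 0 ∨ (S c).card = 1 ∨ (S c).card = 2 ∨ (S c).card = Fintype.card V) →
    S c = S c' → c = c'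

/-- The pair `p` is a member of `S`, and exactly `q - 2` triples of `S` contain it. -/
def IsFull (q : ℕ) (S : ι → Finset V) (p : Finset V) : Prop :=
  (∃ c, S c = p) ∧ (univ.filter fun c => p ⊆ S c ∧ (S c).card = 3).card + 2 = q

/-- Each member of the system spreads weight `1` evenly over the pairs it contains. -/
noncomputable def pairWeight (S : ι → Finset V) (p : Finset V) : ℝ :=
  ∑ c ∈ through S p, 1 / ((S c).card.choose 2 : ℝ)

variable {q : ℕ} {S : ι → Finset V}

/-- The covering form of the hypothesis. For a point of `p` it only needs `T` to be nonempty, hence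
`0 < q`. -/
lemma FewSeparating.exists_mem (h : FewSeparating q S) (hq : 0 < q) {p : Finset V}
    (hp : p.card = 2) {T : Finset ι} (hT : ∀ c ∈ T, p ⊆ S c) (hTq : q ≤ T.card) (k : V) :
    ∃ c ∈ T, k ∈ S c := by
  by_cases hk : k ∈ p
  · obtain ⟨c, hc⟩ : T.Nonempty := card_pos.1 (by omega)
    exact ⟨c, hc, hT c hc hk⟩
  · by_contra! hcon
    have := h p hp k hk
    have h2 : T ⊆ univ.filter fun c => p ⊆ S c ∧ k ∉ S c := fun c hc => by
      simp [hT c hc, hcon c hc]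
    have := card_le_card h2
    omega

/-- The members through `p` that have fewer than `|V| / q` points. -/
def smallThrough (q : ℕ) (S : ι → Finset V) (p : Finset V) : Finset ι :=
  univ.filter fun c => p ⊆ S c ∧ q * (S c).card < Fintype.card V

/-- Any `q` members through `p` cover the ground set, but `q` small ones have too few points in
total. -/
lemma FewSeparating.card_smallThrough_lt (h : FewSeparating q S) (hq : 0 < q) {p : Finset V}
    (hp : p.card = 2) : (smallThrough q S p).card < q := by
  by_contra! hcon
  obtain ⟨T, hT, hTq⟩ := exists_subset_card_eq hcon
  have hT' : ∀ c ∈ T, p ⊆ S c ∧ q * (S c).card < Fintype.card V := fun c hc => by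
    simpa [smallThrough] using hT hc
  have h1 : (univ : Finset V) ⊆ T.biUnion S := fun k _ => by
    simpa using h.exists_mem hq hp (fun c hc => (hT' c hc).1) hTq.ge k
  have h2 : Fintype.card V ≤ ∑ c ∈ T, (S c).card := (card_le_card h1).trans card_biUnion_le
  have h3 : ∑ c ∈ T, q * (S c).card < ∑ c ∈ T, Fintype.card V :=
    sum_lt_sum_of_nonempty (card_pos.1 (by omega)) fun c hc => (hT' c hc).2
  rw [← mul_sum, sum_const, hTq, smul_eq_mul] at h3
  exact absurd h3 (not_lt.2 (Nat.mul_le_mul_left _ h2))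

/-- Each proper member through `p` misses some point, and each point is missed by fewer than `q` of
them. -/
lemma FewSeparating.card_through_le (h : FewSeparating q S) {p : Finset V}
    (hp : p.card = 2) : (through S p).card ≤ Fintype.card V * q := by
  have h1 : through S p ⊆ pᶜ.biUnion fun k => univ.filter fun c => p ⊆ S c ∧ k ∉ S c := by
    intro c hc
    simp only [through, mem_filter, mem_univ, true_and] at hc
    obtain ⟨k, hk⟩ : ∃ k, k ∉ S c := by
      by_contra! hcon
      have : S c = univ := eq_univ_iff_forall.2 hcon
      simp [this] at hc
    simp only [mem_biUnion, mem_compl, mem_filter, mem_univ, true_and]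
    exact ⟨k, fun h => hk (hc.1 h), hc.1, hk⟩
  refine (card_le_card h1).trans ((card_biUnion_le_card_mul _ _ q fun k hk => ?_).trans ?_)
  · exact (h p hp k (by simpa using hk)).le
  · exact Nat.mul_le_mul_right _ (card_le_univ _)

/-- Exchange the summations: a member of size `s ≥ 2` contributes `s.choose 2` shares of `1 /
s.choose 2`. -/
lemma sum_pairWeight (S : ι → Finset V) :
    ∑ p ∈ powersetCard 2 univ, pairWeight S p =
      ((univ.filter fun c => 2 ≤ (S c).card ∧ (S c).card < Fintype.card V).card : ℝ) := by
  unfold pairWeight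
  rw [sum_comm' (t' := univ.filter fun c => 2 ≤ (S c).card ∧ (S c).card < Fintype.card V)
    (s' := fun c => powersetCard 2 (S c))]
  · rw [card_eq_sum_ones, Nat.cast_sum]
    refine sum_congr rfl fun c hc => ?_
    rw [sum_const, card_powersetCard, nsmul_eq_mul, mul_one_div, Nat.cast_one, div_self]
    simp only [mem_filter, mem_univ, true_and] at hc
    exact_mod_cast (Nat.choose_pos hc.1).ne'
  · intro p c
    simp only [through, mem_powersetCard, mem_filter, mem_univ, true_and, subset_univ]
    constructor
    · rintro ⟨h1, h2, h3⟩
      exact ⟨⟨h2, h1⟩, h1 ▸ card_le_card h2, h3⟩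
    · rintro ⟨⟨h2, h1⟩, -, h3⟩
      exact ⟨h1, h2, h3⟩

lemma sq_le_four_mul_choose_two {s : ℕ} (hs : 2 ≤ s) : (s : ℝ) ^ 2 ≤ 4 * (s.choose 2 : ℝ) := by
  rw [Nat.cast_choose_two]
  have : (2 : ℝ) ≤ s := by exact_mod_cast hs
  nlinarith

lemma one_div_choose_le {q m s : ℕ} (hm : 0 < m) (hqm : 2 * q ≤ m) (hs : m ≤ q * s) :
    1 / (s.choose 2 : ℝ) ≤ 4 * (q : ℝ) ^ 2 / (m : ℝ) ^ 2 := by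
  have hq : 0 < q := Nat.pos_of_ne_zero fun h => by simp [h] at hs; omega
  have hs2 : 2 ≤ s := by
    by_contra! h
    have : q * s ≤ q * 1 := Nat.mul_le_mul_left _ (by omega)
    omega
  have hc : (0 : ℝ) < s.choose 2 := by exact_mod_cast Nat.choose_pos hs2
  have hm' : (0 : ℝ) < m := by exact_mod_cast hm
  rw [div_le_div_iff₀ hc (by positivity)]
  have h1 : (m : ℝ) ≤ q * s := by exact_mod_cast hs
  have h2 := sq_le_four_mul_choose_two hs2
  calc 1 * (m : ℝ) ^ 2 ≤ (q * s) ^ 2 := by rw [one_mul]; gcongr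
    _ = (q : ℝ) ^ 2 * s ^ 2 := by ring
    _ ≤ q ^ 2 * (4 * s.choose 2) := by gcongr
    _ = _ := by ring

/-- The shares are `1`, `1/3` and at most `1/6` for sizes `2`, `3` and at least `4`. Written as a
base with surcharges, they sum to a linear expression in three counts. -/
lemma one_div_choose_two_le {s : ℕ} (hs : 2 ≤ s) :
    1 / (s.choose 2 : ℝ) ≤
      1 / 6 + (if s = 2 then 5 / 6 else 0) + (if s = 3 then 1 / 6 else 0) := by
  rcases eq_or_ne s 2 with rfl | h2
  · norm_num
  rcases eq_or_ne s 3 with rfl | h3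
  · norm_num [Nat.choose]
  · have : (6 : ℝ) ≤ s.choose 2 := by
      have h := Nat.choose_le_choose 2 (show 4 ≤ s by omega)
      norm_num [Nat.choose] at h
      exact_mod_cast h
    simp only [h2, h3, if_false, add_zero]
    exact one_div_le_one_div_of_le (by norm_num) this

open Classical in
lemma sum_smallThrough_le (h : FewSeparating q S) (hS : NoRepeats S) (hq : 2 < q)
    (hm : 3 * q < Fintype.card V) {p : Finset V} (hp : p.card = 2) :
    ∑ c ∈ smallThrough q S p, 1 / ((S c).card.choose 2 : ℝ) ≤
      ((q : ℝ) + 1) / 3 - if IsFull q S p then 0 else 1 / 6 := by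
  have hlt := h.card_smallThrough_lt (by omega) hp
  have hmem : ∀ c, c ∈ smallThrough q S p ↔ p ⊆ S c ∧ q * (S c).card < Fintype.card V := by
    simp [smallThrough]
  set A := (smallThrough q S p).filter fun c => (S c).card = 2 with hA
  set B := (smallThrough q S p).filter fun c => (S c).card = 3 with hB
  have hAp : ∀ c ∈ A, S c = p := fun c hc => by
    rw [hA, mem_filter, hmem] at hc
    exact (eq_of_subset_of_card_le hc.1.1 (by omega)).symm
  have hA1 : A.card ≤ 1 := card_le_one.2 fun c hc c' hc' =>
    hS c c' (by rw [hAp c hc, hp]; simp) ((hAp c hc).trans (hAp c' hc').symm)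
  have hAB : A.card + B.card ≤ (smallThrough q S p).card := by
    rw [← card_union_of_disjoint]
    · exact card_le_card (union_subset (filter_subset _ _) (filter_subset _ _))
    · rw [disjoint_left]
      intro c hc hc'
      rw [hA, mem_filter] at hc
      rw [hB, mem_filter] at hc'
      omega
  -- Triples are small because `3 * q` is less than the number of points, so `B` is the set counted
  -- in `IsFull`.
  have hBeq : B = univ.filter fun c => p ⊆ S c ∧ (S c).card = 3 := by
    ext c
    simp only [hB, mem_filter, hmem, mem_univ, true_and]
    constructor
    · rintro ⟨⟨h1, -⟩, h2⟩; exact ⟨h1, h2⟩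
    · rintro ⟨h1, h2⟩; exact ⟨⟨h1, by rw [h2]; omega⟩, h2⟩
  have hsum : ∑ c ∈ smallThrough q S p, 1 / ((S c).card.choose 2 : ℝ) ≤
      (smallThrough q S p).card / 6 + A.card * (5 / 6) + B.card * (1 / 6) := by
    calc _ ≤ ∑ c ∈ smallThrough q S p, ((1 : ℝ) / 6 + (if (S c).card = 2 then 5 / 6 else 0) +
          (if (S c).card = 3 then 1 / 6 else 0)) :=
          sum_le_sum fun c hc => one_div_choose_two_le (hp ▸ card_le_card ((hmem c).1 hc).1)
      _ = _ := by
          rw [sum_add_distrib, sum_add_distrib, ← sum_filter, ← sum_filter, sum_const, sum_const,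
            sum_const]
          simp only [nsmul_eq_mul, ← hA, ← hB]
          ring
  -- If `p` is a member but not full, at most `q - 3` triples remain, and the bound becomes `(q-1)/6
  -- + 5/6 + (q-3)/6`, exactly `1/6` below `(q+1)/3`. If `p` is not a member, the loss is at least
  -- `2/3`.
  have hfull : ¬ IsFull q S p → A.card = 1 → B.card + 3 ≤ q := by
    intro hnf hA1'
    by_contra! hcon
    refine hnf ⟨?_, ?_⟩
    · obtain ⟨c, hc⟩ := card_pos.1 (show 0 < A.card by omega)
      exact ⟨c, hAp c hc⟩
    · rw [← hBeq]; omega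
  have e1 : ((smallThrough q S p).card : ℝ) + 1 ≤ q := by exact_mod_cast hlt
  have e2 : (A.card : ℝ) + B.card ≤ (smallThrough q S p).card := by exact_mod_cast hAB
  have e3 : (A.card : ℝ) ≤ 1 := by exact_mod_cast hA1
  split_ifs with hf
  · linarith
  · rcases Nat.lt_or_ge A.card 1 with h0 | h1
    · have : (A.card : ℝ) = 0 := by exact_mod_cast (show A.card = 0 by omega)
      linarith
    · have : (B.card : ℝ) + 3 ≤ q := by exact_mod_cast hfull hf (by omega)
      linarith

lemma pairWeight_eq_add (hq : 0 < q) (p : Finset V) :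
    pairWeight S p = ∑ c ∈ smallThrough q S p, 1 / ((S c).card.choose 2 : ℝ) +
      ∑ c ∈ (through S p).filter (fun c => Fintype.card V ≤ q * (S c).card),
        1 / ((S c).card.choose 2 : ℝ) := by
  rw [pairWeight, ← sum_filter_add_sum_filter_not _ (fun c => q * (S c).card < Fintype.card V)]
  congr 1
  · refine sum_congr ?_ fun _ _ => rfl
    ext c
    simp only [through, smallThrough, mem_filter, mem_univ, true_and]
    constructor
    · tauto
    · rintro ⟨h1, h2⟩
      exact ⟨⟨h1, (Nat.le_mul_of_pos_left _ hq).trans_lt h2⟩, h2⟩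
  · simp only [not_lt]

-- At most `|V| * q` large proper members pass through `p`, each giving at most `4 * q ^ 2 / |V| ^
-- 2`; this is the error term.
open Classical in
lemma pairWeight_le (h : FewSeparating q S) (hS : NoRepeats S) (hq : 2 < q)
    (hm : 3 * q < Fintype.card V) {p : Finset V} (hp : p.card = 2) :
    pairWeight S p ≤ ((q : ℝ) + 1) / 3 + 4 * (q : ℝ) ^ 3 / Fintype.card V -
      if IsFull q S p then 0 else 1 / 6 := by
  have h1 := sum_smallThrough_le h hS hq hm hp
  have hm0 : (0 : ℝ) < Fintype.card V := by exact_mod_cast (show 0 < Fintype.card V by omega)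
  have h2 : ∑ c ∈ (through S p).filter (fun c => Fintype.card V ≤ q * (S c).card),
        1 / ((S c).card.choose 2 : ℝ) ≤ 4 * (q : ℝ) ^ 3 / Fintype.card V := by
    calc _ ≤ ∑ c ∈ (through S p).filter (fun c => Fintype.card V ≤ q * (S c).card),
          4 * (q : ℝ) ^ 2 / (Fintype.card V : ℝ) ^ 2 :=
          sum_le_sum fun c hc => one_div_choose_le (by omega) (by omega) (mem_filter.1 hc).2
      _ ≤ (Fintype.card V * q : ℝ) * (4 * (q : ℝ) ^ 2 / (Fintype.card V : ℝ) ^ 2) := by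
          rw [sum_const, nsmul_eq_mul]
          gcongr
          exact_mod_cast (card_le_card (filter_subset _ _)).trans (h.card_through_le hp)
      _ = _ := by field_simp
  rw [pairWeight_eq_add (by omega : 0 < q)]
  linarith

/-! ### Large members destroy extremality. -/

open Classical in
/-- A large member leaves only linearly many of its pairs full. -/
lemma card_full_pairs_le (h : FewSeparating q S) (hq : 2 < q) (hm : 3 * q < Fintype.card V)
    {c₀ : ι} (h₀ : (S c₀).card < Fintype.card V) (h₁ : Fintype.card V ≤ q * (S c₀).card) :
    ((powersetCard 2 (S c₀)).filter fun p => IsFull q S p).card ≤ Fintype.card V * q := by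
  obtain ⟨k, hk⟩ : ∃ k, k ∉ S c₀ := by
    by_contra! hcon
    have : S c₀ = univ := eq_univ_iff_forall.2 hcon
    simp [this] at h₀
  set T := univ.filter fun c => k ∈ S c ∧ (S c).card = 3 with hT
  -- A triple through `k` is a small member through some pair `{i, k}`.
  have hTcard : T.card ≤ Fintype.card V * q := by
    have h2 : T ⊆ (univ.erase k).biUnion fun i => smallThrough q S {i, k} := by
      intro c hc
      simp only [hT, mem_filter, mem_univ, true_and] at hc
      obtain ⟨i, hi, hik⟩ := exists_mem_ne (show 1 < (S c).card by omega) k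
      simp only [mem_biUnion, mem_erase, mem_univ, and_true, smallThrough, mem_filter, true_and]
      refine ⟨i, hik, ?_, by rw [hc.2]; omega⟩
      intro x hx
      rcases mem_insert.1 hx with rfl | hx
      · exact hi
      · rw [mem_singleton.1 hx]; exact hc.1
    refine (card_le_card h2).trans ((card_biUnion_le_card_mul _ _ q fun i hi => ?_).trans ?_)
    · exact (h.card_smallThrough_lt (by omega) (card_pair (by simpa using hi))).le
    · exact Nat.mul_le_mul_right _ (card_le_univ _)
  -- Each full pair inside `S c₀` will be a triple through `k` with `k` removed.
  refine le_trans (card_le_card ?_) ((card_image_le (f := fun c => (S c).erase k)).trans hTcard)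
  intro p hp
  simp only [mem_filter, mem_powersetCard] at hp
  obtain ⟨⟨hpS, hp2⟩, ⟨c₂, hc₂⟩, hcard⟩ := hp
  have hkp : k ∉ p := fun h => hk (hpS h)
  set B := univ.filter fun c => p ⊆ S c ∧ (S c).card = 3 with hB
  have hc2B : c₂ ∉ B := by
    simp only [hB, mem_filter, mem_univ, true_and, not_and]
    intro _; rw [hc₂]; omega
  have hc0B : c₀ ∉ insert c₂ B := by
    have h3 : 3 < (S c₀).card := by
      by_contra! hle
      have : q * (S c₀).card ≤ q * 3 := Nat.mul_le_mul_left _ hle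
      omega
    simp only [hB, mem_insert, mem_filter, mem_univ, true_and, not_or, not_and]
    refine ⟨fun e => ?_, fun _ => by omega⟩
    rw [e, hc₂] at h3
    omega
  -- These are exactly `q` members through `p`; neither `c₀` nor `c₂` contains `k`, so a triple in
  -- `B` does.
  obtain ⟨c, hc, hkc⟩ := h.exists_mem (by omega) hp2 (T := insert c₀ (insert c₂ B))
    (by
      intro c hc
      rcases mem_insert.1 hc with rfl | hc
      · exact hpS
      rcases mem_insert.1 hc with rfl | hc
      · exact hc₂.ge
      · exact (mem_filter.1 hc).2.1)
    (by rw [card_insert_of_notMem hc0B, card_insert_of_notMem hc2B]; omega) k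
  rcases mem_insert.1 hc with rfl | hc
  · exact absurd hkc hk
  rcases mem_insert.1 hc with rfl | hc
  · exact absurd (hc₂ ▸ hkc) hkp
  · obtain ⟨-, hpc, hc3⟩ := mem_filter.1 hc
    refine mem_image.2 ⟨c, by simp [hT, hkc, hc3], ?_⟩
    refine (eq_of_subset_of_card_le (fun x hx => mem_erase.2 ⟨?_, hpc hx⟩) ?_).symm
    · rintro rfl; exact hkp hx
    · rw [card_erase_of_mem hkc]; omega

/-- In the presence of a large member, the total weight of the pairs is not extremal. -/
lemma sum_pairWeight_lt_of_large (h : FewSeparating q S) (hS : NoRepeats S) (hq : 2 < q)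
    (hm : 60 * q ^ 5 < Fintype.card V)
    {c₀ : ι} (h₀ : (S c₀).card < Fintype.card V) (h₁ : Fintype.card V ≤ q * (S c₀).card) :
    ∑ p ∈ powersetCard 2 univ, pairWeight S p <
      ((q : ℝ) + 1) / 3 * ((Fintype.card V).choose 2 : ℝ) := by
  classical
  have hq5 : q ≤ q ^ 5 := Nat.le_self_pow (by norm_num) q
  have hm3 : 3 * q < Fintype.card V := by omega
  set m := Fintype.card V with hmdef
  set N := ((powersetCard 2 univ).filter fun p => ¬ IsFull q S p).card with hN
  have hsum : ∑ p ∈ powersetCard 2 univ, pairWeight S p ≤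
      (m.choose 2 : ℝ) * (((q : ℝ) + 1) / 3 + 4 * (q : ℝ) ^ 3 / m) - N * (1 / 6) := by
    calc _ ≤ ∑ p ∈ powersetCard 2 (univ : Finset V), (((q : ℝ) + 1) / 3 + 4 * (q : ℝ) ^ 3 / m -
          if IsFull q S p then 0 else 1 / 6) :=
          sum_le_sum fun p hp => pairWeight_le h hS hq hm3 (mem_powersetCard.1 hp).2
      _ = _ := by
          rw [sum_sub_distrib, sum_const, card_powersetCard, card_univ, nsmul_eq_mul]
          congr 1
          rw [hN, ← nsmul_eq_mul, ← sum_const, sum_filter]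
          exact sum_congr rfl fun p _ => by split_ifs <;> simp_all
  have hs2 : 2 ≤ (S c₀).card := by
    by_contra! hlt
    have : q * (S c₀).card ≤ q * 1 := Nat.mul_le_mul_left _ (by omega)
    omega
  -- Split the pairs of `S c₀` into non-full ones, counted by `N`, and full ones.
  have hNge : (S c₀).card.choose 2 ≤ N + m * q := by
    rw [← card_powersetCard, ← card_filter_add_card_filter_not (fun p => ¬ IsFull q S p)]
    simp only [not_not]
    refine add_le_add (card_le_card (filter_subset_filter _ ?_))
      (card_full_pairs_le h hq hm3 h₀ h₁)
    exact powersetCard_mono (subset_univ _)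
  have hq0 : (2 : ℝ) < q := by exact_mod_cast hq
  have hm0 : (0 : ℝ) < m := by exact_mod_cast (show 0 < m by omega)
  have e1 : ((S c₀).card.choose 2 : ℝ) ≤ N + m * q := by exact_mod_cast hNge
  have e2 := sq_le_four_mul_choose_two hs2
  have e3 : (m : ℝ) ≤ q * (S c₀).card := by exact_mod_cast h₁
  have e4 : (m : ℝ) ^ 2 ≤ 4 * q ^ 2 * (N + m * q) := by
    calc (m : ℝ) ^ 2 ≤ (q * (S c₀).card) ^ 2 := by gcongr
      _ = q ^ 2 * ((S c₀).card : ℝ) ^ 2 := by ring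
      _ ≤ q ^ 2 * (4 * (N + m * q)) := by gcongr; linarith
      _ = _ := by ring
  have e5 : 60 * (q : ℝ) ^ 5 < m := by exact_mod_cast hm
  have e6 : (m.choose 2 : ℝ) * (4 * (q : ℝ) ^ 3 / m) ≤ 2 * q ^ 3 * m := by
    rw [Nat.cast_choose_two]
    have : (m : ℝ) * (m - 1) / 2 * (4 * (q : ℝ) ^ 3 / m) = 2 * q ^ 3 * (m - 1) := by
      field_simp
      ring
    rw [this]
    gcongr
    linarith
  -- The deficit must beat the error, which needs `N > 12 q³ m`. From `m > 60 q⁵` and `e4` one gets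
  -- `N + m q > 15 q³ m`, hence `N > 14 q³ m`.
  have e7 : 2 * (q : ℝ) ^ 3 * m < N * (1 / 6) := by
    have : 60 * (q : ℝ) ^ 5 * m < m ^ 2 := by rw [sq]; gcongr
    have e8 : 4 * (q : ℝ) ^ 2 * (15 * q ^ 3 * m) < 4 * q ^ 2 * (N + m * q) := by
      calc _ = 60 * (q : ℝ) ^ 5 * m := by ring
        _ < m ^ 2 := this
        _ ≤ _ := e4
    have e9 := lt_of_mul_lt_mul_left e8 (by positivity)
    have e10 : (q : ℝ) * m ≤ q ^ 3 * m := by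
      gcongr
      exact le_self_pow₀ (by linarith) (by norm_num)
    nlinarith
  have : (m.choose 2 : ℝ) * (((q : ℝ) + 1) / 3 + 4 * (q : ℝ) ^ 3 / m) =
      ((q : ℝ) + 1) / 3 * m.choose 2 + (m.choose 2 : ℝ) * (4 * (q : ℝ) ^ 3 / m) := by ring
  linarith

/-- With a large proper member the inequality is strict. Without one there is no error term, so the
bound holds pair by pair, and equality of the sums forces equality at each pair. -/
lemma sum_pairWeight_le (h : FewSeparating q S) (hS : NoRepeats S) (hq : 2 < q)
    (hm : 60 * q ^ 5 < Fintype.card V) :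
    ∑ p ∈ powersetCard 2 univ, pairWeight S p ≤
        ((q : ℝ) + 1) / 3 * ((Fintype.card V).choose 2 : ℝ) ∧
      (∑ p ∈ powersetCard 2 univ, pairWeight S p =
        ((q : ℝ) + 1) / 3 * ((Fintype.card V).choose 2 : ℝ) →
        (∀ p : Finset V, p.card = 2 → IsFull q S p) ∧
        ∀ c, (S c).card < Fintype.card V → q * (S c).card < Fintype.card V) := by
  classical
  have hq5 : q ≤ q ^ 5 := Nat.le_self_pow (by norm_num) q
  by_cases hbig : ∃ c₀, (S c₀).card < Fintype.card V ∧ Fintype.card V ≤ q * (S c₀).card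
  · obtain ⟨c₀, h₀, h₁⟩ := hbig
    have := sum_pairWeight_lt_of_large h hS hq hm h₀ h₁
    exact ⟨this.le, fun e => absurd e this.ne⟩
  · push Not at hbig
    have hle : ∀ p ∈ powersetCard 2 (univ : Finset V), pairWeight S p ≤
        ((q : ℝ) + 1) / 3 - if IsFull q S p then 0 else 1 / 6 := fun p hp => by
      rw [pairWeight_eq_add (by omega : 0 < q), filter_eq_empty_iff.2, sum_empty, add_zero]
      · exact sum_smallThrough_le h hS hq (by omega) (mem_powersetCard.1 hp).2
      · intro c hc
        simp only [through, mem_filter, mem_univ, true_and] at hc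
        exact not_le.2 (hbig c hc.2)
    have hle' : ∀ p ∈ powersetCard 2 (univ : Finset V), pairWeight S p ≤ ((q : ℝ) + 1) / 3 :=
      fun p hp => (hle p hp).trans (by split_ifs <;> linarith)
    have hconst : ∑ p ∈ powersetCard 2 (univ : Finset V), ((q : ℝ) + 1) / 3 =
        ((q : ℝ) + 1) / 3 * ((Fintype.card V).choose 2 : ℝ) := by
      rw [sum_const, card_powersetCard, card_univ, nsmul_eq_mul, mul_comm]
    rw [← hconst]
    refine ⟨sum_le_sum hle', fun e => ⟨fun p hp => ?_, hbig⟩⟩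
    have hp' : p ∈ powersetCard 2 (univ : Finset V) := by simp [hp]
    have h1 := (sum_eq_sum_iff_of_le hle').1 e p hp'
    have h2 := hle p hp'
    by_contra hnf
    rw [if_neg hnf] at h2
    linarith

/-! ### The extremal bound and its equality case. -/

lemma card_filter_card_eq_le (hS : NoRepeats S) {t : ℕ} (ht : t = 0 ∨ t = 1 ∨ t = 2 ∨ t = Fintype.card V) :
    (univ.filter fun c => (S c).card = t).card ≤ (Fintype.card V).choose t ∧
      ((univ.filter fun c => (S c).card = t).card = (Fintype.card V).choose t →
        ∀ T : Finset V, T.card = t → ∃ c, S c = T) := by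
  have hinj : Set.InjOn S (univ.filter fun c => (S c).card = t) := fun c hc c' _ e =>
    hS c c' (by rw [(by simpa using hc : (S c).card = t)]; exact ht) e
  have hsub : (univ.filter fun c => (S c).card = t).image S ⊆ powersetCard t univ := by
    intro T hT
    obtain ⟨c, hc, rfl⟩ := mem_image.1 hT
    simpa using hc
  have hcard : (powersetCard t (univ : Finset V)).card = (Fintype.card V).choose t := by
    rw [card_powersetCard, card_univ]
  rw [← hcard, ← card_image_of_injOn hinj]
  refine ⟨card_le_card hsub, fun e T hT => ?_⟩
  have hmem : T ∈ (univ.filter fun c => (S c).card = t).image S := by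
    rw [eq_of_subset_of_card_le hsub e.ge]
    simp [hT]
  obtain ⟨c, -, hc⟩ := mem_image.1 hmem
  exact ⟨c, hc⟩

/-- The extremal bound for systems of sets, with the structure of the extremal systems. -/
theorem card_le_of_fewSeparating (h : FewSeparating q S) (hS : NoRepeats S) (hq : 2 < q)
    (hm : 60 * q ^ 5 < Fintype.card V) :
    (Fintype.card ι : ℝ) ≤ Fintype.card V + 2 +
        ((q : ℝ) + 1) / 3 * ((Fintype.card V).choose 2 : ℝ) ∧
      ((Fintype.card ι : ℝ) = Fintype.card V + 2 +
          ((q : ℝ) + 1) / 3 * ((Fintype.card V).choose 2 : ℝ) →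
        (∀ T : Finset V, (T.card = 0 ∨ T.card = 1 ∨ T.card = 2 ∨ T.card = Fintype.card V) →
          ∃ c, S c = T) ∧
        (∀ p : Finset V, p.card = 2 →
          (univ.filter fun c => p ⊆ S c ∧ (S c).card = 3).card = q - 2) ∧
        ∀ c, (S c).card = 0 ∨ (S c).card = 1 ∨ (S c).card = 2 ∨ (S c).card = 3 ∨
          (S c).card = Fintype.card V) := by
  have hq5 : q ≤ q ^ 5 := Nat.le_self_pow (by norm_num) q
  obtain ⟨hw, hweq⟩ := sum_pairWeight_le h hS hq hm
  rw [sum_pairWeight] at hw hweq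
  obtain ⟨h0, h0e⟩ := card_filter_card_eq_le hS (t := 0) (by simp)
  obtain ⟨h1, h1e⟩ := card_filter_card_eq_le hS (t := 1) (by simp)
  obtain ⟨hv, hve⟩ := card_filter_card_eq_le hS (t := Fintype.card V) (by simp)
  rw [Nat.choose_zero_right] at h0 h0e
  rw [Nat.choose_one_right] at h1 h1e
  rw [Nat.choose_self] at hv hve
  have hsplit : Fintype.card ι = (univ.filter fun c => (S c).card = 0).card +
      (univ.filter fun c => (S c).card = 1).card +
      (univ.filter fun c => (S c).card = Fintype.card V).card +
      (univ.filter fun c => 2 ≤ (S c).card ∧ (S c).card < Fintype.card V).card := by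
    rw [← card_univ, card_eq_sum_ones]
    simp only [card_filter]
    rw [← sum_add_distrib, ← sum_add_distrib, ← sum_add_distrib]
    refine sum_congr rfl fun c _ => ?_
    have := card_le_univ (S c)
    split_ifs <;> omega
  set n0 := (univ.filter fun c => (S c).card = 0).card
  set n1 := (univ.filter fun c => (S c).card = 1).card
  set nv := (univ.filter fun c => (S c).card = Fintype.card V).card
  set n2 := (univ.filter fun c => 2 ≤ (S c).card ∧ (S c).card < Fintype.card V).card
  have e0 : (n0 : ℝ) ≤ 1 := by exact_mod_cast h0
  have e1 : (n1 : ℝ) ≤ Fintype.card V := by exact_mod_cast h1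
  have ev : (nv : ℝ) ≤ 1 := by exact_mod_cast hv
  have es : (Fintype.card ι : ℝ) = n0 + n1 + nv + n2 := by exact_mod_cast hsplit
  refine ⟨by linarith, fun e => ?_⟩
  obtain ⟨hfull, hsmall⟩ := hweq (by linarith)
  have f0 : n0 = 1 := by exact_mod_cast (show (n0 : ℝ) = 1 by linarith)
  have f1 : n1 = Fintype.card V := by
    exact_mod_cast (show (n1 : ℝ) = Fintype.card V by linarith)
  have fv : nv = 1 := by exact_mod_cast (show (nv : ℝ) = 1 by linarith)
  refine ⟨?_, fun p hp => by have := (hfull p hp).2; omega, fun c => ?_⟩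
  · rintro T (hT | hT | hT | hT)
    · exact h0e f0 T hT
    · exact h1e f1 T hT
    · exact (hfull T hT).1
    · exact hve fv T hT
  · by_contra! hc
    have hlt : (S c).card < Fintype.card V := lt_of_le_of_ne (card_le_univ _) hc.2.2.2.2
    have hs := hsmall c hlt
    obtain ⟨p, hpc, hp⟩ := exists_subset_card_eq (show 2 ≤ (S c).card by omega)
    obtain ⟨⟨c₂, hc₂⟩, hB⟩ := hfull p hp
    have hlt := h.card_smallThrough_lt (by omega) hp
    -- A member of any other size would join the pair and its `q - 2` triples to make `q` small
    -- members through `p`.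
    have hsub : insert c (insert c₂ (univ.filter fun c => p ⊆ S c ∧ (S c).card = 3)) ⊆
        smallThrough q S p := by
      intro x hx
      simp only [mem_insert, mem_filter, mem_univ, true_and] at hx
      simp only [smallThrough, mem_filter, mem_univ, true_and]
      rcases hx with rfl | rfl | hx
      · exact ⟨hpc, hs⟩
      · exact ⟨hc₂.ge, by rw [hc₂, hp]; omega⟩
      · exact ⟨hx.1, by rw [hx.2]; omega⟩
    have := card_le_card hsub
    rw [card_insert_of_notMem, card_insert_of_notMem] at this
    · omega
    · simp only [mem_filter, mem_univ, true_and, not_and]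
      intro _; rw [hc₂]; omega
    · simp only [mem_insert, mem_filter, mem_univ, true_and, not_or, not_and]
      refine ⟨fun e => ?_, fun _ => hc.2.2.2.1⟩
      rw [e, hc₂] at hc
      omega

end SetSystems

end ForbConfig
namespace ForbConfig

/-! ### Families of pairwise disjoint Steiner triple systems. -/

section Designs

open Finset

/-- A family of Steiner triple systems on `P`, given by the map that completes two distinct points
to a triple, no two of which share a triple. -/
structure DisjointTripleSystems (κ P : Type*) where
  /-- The third point of the triple through two points. -/
  third : κ → P → P → P
  third_comm : ∀ c x y, x ≠ y → third c x y = third c y x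
  third_ne : ∀ c x y, x ≠ y → third c x y ≠ x
  third_third : ∀ c x y, x ≠ y → third c x (third c x y) = y
  disjoint : ∀ c c' x y, x ≠ y → third c x y = third c' x y → c = c'

/-- Transport along an equivalence of the point sets. -/
def DisjointTripleSystems.congr {κ P Q : Type*} (D : DisjointTripleSystems κ P) (e : P ≃ Q) :
    DisjointTripleSystems κ Q where
  third c x y := e (D.third c (e.symm x) (e.symm y))
  third_comm c x y h := by rw [D.third_comm c _ _ (e.symm.injective.ne h)]
  third_ne c x y h := fun h' => D.third_ne c _ _ (e.symm.injective.ne h) (by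
    rw [← e.symm_apply_apply (D.third c _ _), h'])
  third_third c x y h := by
    rw [e.symm_apply_apply, D.third_third c _ _ (e.symm.injective.ne h), e.apply_symm_apply]
  disjoint c c' x y h h' := D.disjoint c c' _ _ (e.symm.injective.ne h) (e.injective h')

namespace DisjointTripleSystems

variable {κ P : Type*} (D : DisjointTripleSystems κ P)

lemma third_ne' (c : κ) {x y : P} (h : x ≠ y) : D.third c x y ≠ y := by
  rw [D.third_comm c x y h]; exact D.third_ne c y x h.symm

variable [DecidableEq P]

/-- The triple of the system `c` through two points. -/
def triple (c : κ) (x y : P) : Finset P := {x, y, D.third c x y}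

lemma card_triple (c : κ) {x y : P} (h : x ≠ y) : (D.triple c x y).card = 3 :=
  card_eq_three.2 ⟨x, y, _, h, (D.third_ne c x y h).symm, (D.third_ne' c h).symm, rfl⟩

lemma triple_comm (c : κ) {x y : P} (h : x ≠ y) : D.triple c x y = D.triple c y x := by
  rw [triple, triple, D.third_comm c x y h]
  exact insert_comm _ _ _

lemma triple_third (c : κ) {x y : P} (h : x ≠ y) :
    D.triple c x (D.third c x y) = D.triple c x y := by
  rw [triple, triple, D.third_third c x y h, pair_comm]

/-- Any two points of a triple determine it, so each system has exactly one triple through each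
pair. -/
lemma triple_eq (c : κ) {x y i j : P} (h : x ≠ y) (hi : i ∈ D.triple c x y)
    (hj : j ∈ D.triple c x y) (hij : i ≠ j) : D.triple c x y = D.triple c i j := by
  have hx := D.third_ne c x y h
  have hy := D.third_ne' c h
  have key : D.triple c x y = D.triple c y (D.third c x y) := by
    rw [D.triple_comm c h, D.third_comm c x y h, D.triple_third c h.symm]
  simp only [triple, mem_insert, mem_singleton] at hi hj
  rcases hi with rfl | rfl | rfl <;> rcases hj with rfl | rfl | rfl <;> try exact absurd rfl hij
  · rfl
  · rw [D.triple_third c h]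
  · rw [D.triple_comm c h]
  · exact key
  · rw [D.triple_comm c hx, D.triple_third c h]
  · rw [D.triple_comm c hy, ← key]

/-- The triples of all systems of the family form a simple 2-design. -/
lemma exists_triples [Fintype κ] [Fintype P] (D : DisjointTripleSystems κ P) :
    ∃ B : Finset (Finset P), (∀ b ∈ B, b.card = 3) ∧
      ∀ i j, i ≠ j → (B.filter fun b => i ∈ b ∧ j ∈ b).card = Fintype.card κ := by
  classical
  refine ⟨univ.filter fun b => ∃ c x y, x ≠ y ∧ b = D.triple c x y, ?_, fun i j hij => ?_⟩
  · intro b hb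
    obtain ⟨c, x, y, h, rfl⟩ := (mem_filter.1 hb).2
    exact D.card_triple c h
  · rw [← card_univ, ← card_image_of_injective (f := fun c => D.triple c i j) univ]
    · congr 1
      ext b
      simp only [mem_filter, mem_univ, true_and, mem_image]
      constructor
      · rintro ⟨⟨c, x, y, h, rfl⟩, hi, hj⟩
        exact ⟨c, (D.triple_eq c h hi hj hij).symm⟩
      · rintro ⟨c, rfl⟩
        exact ⟨⟨c, i, j, hij, rfl⟩, by simp [triple], by simp [triple]⟩
    · intro c c' h
      have hm : D.third c i j ∈ D.triple c' i j := by
        rw [← show D.triple c i j = D.triple c' i j from h]; simp [triple]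
      simp only [triple, mem_insert, mem_singleton, D.third_ne c i j hij, D.third_ne' c hij,
        false_or] at hm
      exact D.disjoint c c' i j hij hm

end DisjointTripleSystems

/-! ### The twisted Bose construction, for `v ≡ 3 (mod 6)`. -/

/-- The shifts that twist the classical constructions: `t, t, -2t` on the three levels. -/
def twist {Y : Type*} [AddCommGroup Y] (t : Y) (i : ZMod 3) : Y := if i = 2 then -(t + t) else t

/-- Zero total shift is what makes the vertical triples, with one point on each level, close up
after going round the three levels. -/
lemma twist_sum {Y : Type*} [AddCommGroup Y] (t : Y) (i : ZMod 3) :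
    twist t i + twist t (i + 1) + twist t (i + 2) = 0 := by
  fin_cases i
  · change t + t + -(t + t) = 0
    abel
  · change t + -(t + t) + t = 0
    abel
  · change -(t + t) + t + t = 0
    abel

lemma zmod_three_cases (i j : ZMod 3) : j = i ∨ j = i + 1 ∨ i = j + 1 := by
  revert i j; decide

lemma zmod_three_ne (i : ZMod 3) : i + 1 ≠ i ∧ i ≠ i + 1 ∧ i + 2 ≠ i + 1 ∧ i + 2 ≠ i ∧
    i + 1 + 1 = i + 2 ∧ i + 2 + 1 = i ∧ i + 1 + 2 = i ∧ i + 2 + 2 = i + 1 ∧ i - 1 + 1 = i ∧ i + 1 - 1 = i ∧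
    i - 1 ≠ i ∧ i - 1 + 2 = i + 1 ∧ i ≠ i + 2 := by
  revert i; decide

/-- A twisted Bose construction: the third point of a triple on `Y × ZMod 3`, where `half` halves
the elements of the group `Y`. -/
def boseThird {Y : Type*} [AddCommGroup Y] [DecidableEq Y] (half : Y → Y) (t : Y)
    (p r : Y × ZMod 3) : Y × ZMod 3 :=
  let up (x : Y) (i : ZMod 3) (z : Y) : Y × ZMod 3 :=
    -- The first case is the vertical triple; otherwise solve `half (x + y) + twist t i = z` for `y`
    -- on level `i`.
    if z = x + twist t i then (z + twist t (i + 1), i + 2)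
    else ((z - twist t i) + (z - twist t i) - x, i)
  if r.2 = p.2 then (half (p.1 + r.1) + twist t p.2, p.2 + 1)
  else if r.2 = p.2 + 1 then up p.1 p.2 r.1
  else up r.1 r.2 p.1

section Bose

variable {Y : Type*} [AddCommGroup Y] [DecidableEq Y] {half : Y → Y}

lemma boseThird_same (t x y : Y) (i : ZMod 3) :
    boseThird half t (x, i) (y, i) = (half (x + y) + twist t i, i + 1) := by
  simp [boseThird]

lemma boseThird_up (t x z : Y) (i : ZMod 3) :
    boseThird half t (x, i) (z, i + 1) =
      if z = x + twist t i then (z + twist t (i + 1), i + 2)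
      else ((z - twist t i) + (z - twist t i) - x, i) := by
  simp [boseThird]

lemma boseThird_down (t x z : Y) (i : ZMod 3) :
    boseThird half t (z, i + 1) (x, i) =
      if z = x + twist t i then (z + twist t (i + 1), i + 2)
      else ((z - twist t i) + (z - twist t i) - x, i) := by
  have h := zmod_three_ne i
  have : i ≠ i + 1 + 1 := by rw [h.2.2.2.2.1]; exact h.2.2.2.1.symm
  simp [boseThird, this]

lemma boseThird_comm (t : Y) (p r : Y × ZMod 3) :
    boseThird half t p r = boseThird half t r p := by
  obtain ⟨x, i⟩ := p
  obtain ⟨y, j⟩ := r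
  rcases zmod_three_cases i j with rfl | rfl | rfl
  · rw [boseThird_same, boseThird_same, add_comm x y]
  · rw [boseThird_up, boseThird_down]
  · rw [boseThird_up, boseThird_down]

lemma boseThird_ne (t : Y) (p r : Y × ZMod 3) (hpr : p ≠ r)
    (hdouble : ∀ y z : Y, y + y = z + z → y = z) :
    boseThird half t p r ≠ p := by
  obtain ⟨x, i⟩ := p
  obtain ⟨y, j⟩ := r
  rcases zmod_three_cases i j with rfl | rfl | rfl
  · rw [boseThird_same]
    intro h
    exact (zmod_three_ne j).1 (congrArg Prod.snd h)
  · rw [boseThird_up]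
    split_ifs with h
    · intro h'
      exact (zmod_three_ne i).2.2.2.1 (congrArg Prod.snd h')
    · intro h'
      have h1 : (y - twist t i) + (y - twist t i) - x = x := congrArg Prod.fst h'
      have := hdouble _ _ (sub_eq_iff_eq_add.1 h1)
      exact h (sub_eq_iff_eq_add.1 this)
  · rw [boseThird_down]
    split_ifs with h
    · intro h'
      exact (zmod_three_ne j).2.2.1 (congrArg Prod.snd h')
    · intro h'
      exact (zmod_three_ne j).2.1 (congrArg Prod.snd h')

lemma boseThird_boseThird (hh : ∀ y, half y + half y = y)
    (hdouble : ∀ y z : Y, y + y = z + z → y = z) (t : Y) (p r : Y × ZMod 3) (hpr : p ≠ r) :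
    boseThird half t p (boseThird half t p r) = r := by
  obtain ⟨x, i⟩ := p
  obtain ⟨y, j⟩ := r
  have hhalf : ∀ y, half (y + y) = y := fun y => hdouble _ _ (hh _)
  rcases zmod_three_cases i j with rfl | rfl | rfl
  · have hxy : x ≠ y := fun h => hpr (by rw [h])
    rw [boseThird_same, boseThird_up, if_neg, add_sub_cancel_right, hh, add_sub_cancel_left]
    intro h
    have h1 := add_right_cancel h
    have := hh (x + y)
    rw [h1] at this
    exact hxy (add_left_cancel this)
  · obtain ⟨-, -, -, -, h12, h21, -, h22, -⟩ := zmod_three_ne i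
    have ht := twist_sum t i
    rw [boseThird_up]
    split_ifs with h
    · have e := boseThird_down (half := half) t (y + twist t (i + 1)) x (i + 2)
      rw [h21] at e
      have hx : x = y + twist t (i + 1) + twist t (i + 2) := by
        rw [h, add_assoc, add_assoc, ← add_assoc (twist t i), ht, add_zero]
      rw [e, if_pos hx, h22, h]
    · rw [boseThird_same, add_sub_cancel, hhalf, sub_add_cancel]
  · obtain ⟨-, -, -, -, h12, h21, h12', h22, -⟩ := zmod_three_ne j
    have ht := twist_sum t j
    rw [boseThird_down]
    split_ifs with h
    · rw [← h12, boseThird_up, if_pos rfl, h12, h12']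
      congr 1
      rw [h, ← sub_eq_zero, ← ht]
      abel
    · rw [boseThird_down, if_neg]
      · congr 1
        abel
      · intro h'
        rw [← sub_eq_iff_eq_add] at h'
        have h2 : x - twist t j + y = x - twist t j + (x - twist t j) :=
          eq_sub_iff_add_eq.1 h'
        exact h (sub_eq_iff_eq_add.1 (add_left_cancel h2).symm)

/-- The level of the third point shows which case applies, and within each case its coordinate
determines the shift. This gives disjointness of the systems. -/
lemma boseThird_injective (hdouble : ∀ y z : Y, y + y = z + z → y = z) (t t' : Y)
    (p r : Y × ZMod 3) (h : boseThird half t p r = boseThird half t' p r)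
    (htw : ∀ i, twist t i = twist t' i → t = t') : t = t' := by
  have up : ∀ (x z : Y) (i : ZMod 3),
      boseThird half t (x, i) (z, i + 1) = boseThird half t' (x, i) (z, i + 1) → t = t' := by
    intro x z i h
    rw [boseThird_up, boseThird_up] at h
    split_ifs at h with h1 h2 h2
    · exact htw i (add_left_cancel (h1.symm.trans h2))
    · exact absurd (congrArg Prod.snd h) (zmod_three_ne i).2.2.2.1
    · exact absurd (congrArg Prod.snd h).symm (zmod_three_ne i).2.2.2.1
    · have := hdouble _ _ (sub_left_injective (congrArg Prod.fst h))
      exact htw i (sub_right_injective this)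
  obtain ⟨x, i⟩ := p
  obtain ⟨y, j⟩ := r
  rcases zmod_three_cases i j with rfl | rfl | rfl
  · rw [boseThird_same, boseThird_same] at h
    exact htw j (add_left_cancel (congrArg Prod.fst h))
  · exact up _ _ _ h
  · rw [boseThird_comm t, boseThird_comm t'] at h
    exact up _ _ _ h

end Bose

/-! ### The twisted Skolem construction, for `v ≡ 1 (mod 6)`. -/

/-- Shifting of the first coordinate. -/
def shift {Y : Type*} [AddCommGroup Y] (t : Y) (x : Y × Bool) : Y × Bool := (x.1 + t, x.2)

/-- A twisted Skolem construction: the third point of a triple on `(Y × Bool) × ZMod 3` and a point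
at infinity, where `g` is a commutative quasigroup on `Y × Bool` with left division `d` and
`g (a, e) (a, e) = (a, false)`. -/
def skolemThird {Y : Type*} [AddCommGroup Y] [DecidableEq Y]
    (g d : Y × Bool → Y × Bool → Y × Bool) (t : Y) :
    Option ((Y × Bool) × ZMod 3) → Option ((Y × Bool) × ZMod 3) → Option ((Y × Bool) × ZMod 3) :=
  let inf (x : Y × Bool) (i : ZMod 3) : Option ((Y × Bool) × ZMod 3) :=
    if x.2 then some ((x.1 + twist t i, false), i + 1)
    else some ((x.1 - twist t (i - 1), true), i - 1)
  let up (x : Y × Bool) (i : ZMod 3) (z : Y × Bool) : Option ((Y × Bool) × ZMod 3) :=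
    -- Here the quasigroup would pair `x` with itself, so `z` is the shift of `g x x`. The pair then
    -- belongs to a triple with infinity if the flag of `x` is true, and to a vertical triple if it
    -- is false.
    if d x (shift (-twist t i) z) = x then
      if x.2 then none else some ((z.1 + twist t (i + 1), false), i + 2)
    else some (d x (shift (-twist t i) z), i)
  fun p r => match p, r with
  | none, none => none
  | none, some (x, i) => inf x i
  | some (x, i), none => inf x i
  | some (x, i), some (y, j) =>
    if j = i then some (shift (twist t i) (g x y), i + 1)
    else if j = i + 1 then up x i y
    else up y j x

section Skolem

variable {Y : Type*} [AddCommGroup Y] [DecidableEq Y] {g d : Y × Bool → Y × Bool → Y × Bool}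

lemma skolemThird_none_true (t a : Y) (i : ZMod 3) :
    skolemThird g d t none (some ((a, true), i)) = some ((a + twist t i, false), i + 1) := rfl

lemma skolemThird_none_false (t a : Y) (i : ZMod 3) :
    skolemThird g d t none (some ((a, false), i)) =
      some ((a - twist t (i - 1), true), i - 1) := rfl

lemma skolemThird_same (t : Y) (x y : Y × Bool) (i : ZMod 3) :
    skolemThird g d t (some (x, i)) (some (y, i)) =
      some (shift (twist t i) (g x y), i + 1) := by
  simp [skolemThird]

lemma skolemThird_up (t : Y) (x z : Y × Bool) (i : ZMod 3) :
    skolemThird g d t (some (x, i)) (some (z, i + 1)) =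
      if d x (shift (-twist t i) z) = x then
        if x.2 then none else some ((z.1 + twist t (i + 1), false), i + 2)
      else some (d x (shift (-twist t i) z), i) := by
  simp [skolemThird]

lemma skolemThird_comm (hg : ∀ x y, g x y = g y x) (t : Y)
    (p r : Option ((Y × Bool) × ZMod 3)) :
    skolemThird g d t p r = skolemThird g d t r p := by
  rcases p with - | ⟨x, i⟩ <;> rcases r with - | ⟨y, j⟩ <;> try rfl
  rcases zmod_three_cases i j with rfl | rfl | rfl
  · rw [skolemThird_same, skolemThird_same, hg]
  · have h := zmod_three_ne i
    simp only [skolemThird]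
    rw [if_neg h.1, if_pos trivial, if_neg h.2.1, h.2.2.2.2.1, if_neg h.2.2.2.1.symm]
  · have h := zmod_three_ne j
    simp only [skolemThird]
    rw [if_neg h.2.1, h.2.2.2.2.1, if_neg h.2.2.2.1.symm, if_neg h.1, if_pos trivial]

lemma skolemThird_ne (hg : ∀ x y, g x y = g y x) (t : Y)
    (p r : Option ((Y × Bool) × ZMod 3)) (hpr : p ≠ r) : skolemThird g d t p r ≠ p := by
  rcases p with - | ⟨x, i⟩
  · rcases r with - | ⟨⟨a, e⟩, i⟩
    · exact absurd rfl hpr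
    · cases e
      · rw [skolemThird_none_false]; simp
      · rw [skolemThird_none_true]; simp
  · rcases r with - | ⟨y, j⟩
    · rw [skolemThird_comm hg]
      obtain ⟨a, e⟩ := x
      cases e
      · rw [skolemThird_none_false]
        intro h
        simp at h
      · rw [skolemThird_none_true]
        intro h
        simp at h
    · rcases zmod_three_cases i j with rfl | rfl | rfl
      · rw [skolemThird_same]
        intro h
        simp [(zmod_three_ne j).1] at h
      · rw [skolemThird_up]
        split_ifs with h1 h2
        · simp
        · intro h
          simp [(zmod_three_ne i).2.2.2.1] at h
        · intro h
          simp only [Option.some.injEq, Prod.mk.injEq, and_true] at h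
          exact h1 h
      · rw [skolemThird_comm hg, skolemThird_up]
        split_ifs with h1 h2
        · simp
        · intro h
          simp only [Option.some.injEq, Prod.mk.injEq] at h
          exact (zmod_three_ne j).2.2.1 h.2
        · intro h
          simp only [Option.some.injEq, Prod.mk.injEq] at h
          exact (zmod_three_ne j).2.1 h.2

lemma skolemThird_skolemThird (hg : ∀ x y, g x y = g y x) (hd : ∀ x y, d x (g x y) = y)
    (hgd : ∀ x z, g x (d x z) = z) (hgg : ∀ a e, g (a, e) (a, e) = (a, false)) (t : Y)
    (p r : Option ((Y × Bool) × ZMod 3)) (hpr : p ≠ r) :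
    skolemThird g d t p (skolemThird g d t p r) = r := by
  have hs : ∀ (s : Y) x, shift (-s) (shift s x) = x := fun s x => by simp [shift]
  have hs' : ∀ (s : Y) x, shift s (shift (-s) x) = x := fun s x => by simp [shift]
  have hdd : ∀ a e, d (a, e) (a, false) = (a, e) := fun a e => by rw [← hgg a e, hd]
  have hdx : ∀ (s a b : Y) (e e' : Bool), d (a, e) (shift (-s) (b, e')) = (a, e) →
      b = a + s ∧ e' = false := fun s a b e e' h => by
    have := hgd (a, e) (shift (-s) (b, e'))
    rw [h, hgg] at this
    simp only [shift, Prod.mk.injEq] at this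
    exact ⟨by rw [this.1]; abel, this.2.symm⟩
  rcases p with - | ⟨⟨a, e⟩, i⟩
  · rcases r with - | ⟨⟨a, e⟩, i⟩
    · exact absurd rfl hpr
    · cases e
      · rw [skolemThird_none_false, skolemThird_none_true]
        simp
      · rw [skolemThird_none_true, skolemThird_none_false]
        simp
  · rcases r with - | ⟨⟨b, e'⟩, j⟩
    · rw [skolemThird_comm hg t _ none]
      cases e
      · rw [skolemThird_none_false, skolemThird_comm hg]
        have h := skolemThird_up (g := g) (d := d) t (a - twist t (i - 1), true) (a, false) (i - 1)
        rw [sub_add_cancel i 1] at h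
        rw [h, if_pos]
        · simp
        · simp [shift, ← sub_eq_add_neg, hdd]
      · rw [skolemThird_none_true, skolemThird_up, if_pos]
        · simp
        · simp [shift, hdd]
    · rcases zmod_three_cases i j with rfl | rfl | rfl
      · have hxy : (a, e) ≠ (b, e') := fun h => hpr (by rw [h])
        rw [skolemThird_same, skolemThird_up, hs, hd, if_neg hxy.symm]
      · obtain ⟨-, -, -, -, h12, h21, -, h22, -⟩ := zmod_three_ne i
        have ht := twist_sum t i
        rw [skolemThird_up]
        split_ifs with h1 h2
        · obtain ⟨rfl, rfl⟩ := hdx _ _ _ _ _ h1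
          simp only at h2
          subst h2
          rw [skolemThird_comm hg, skolemThird_none_true]
        · obtain ⟨rfl, rfl⟩ := hdx _ _ _ _ _ h1
          simp only [Bool.not_eq_true] at h2
          subst h2
          have h := skolemThird_up (g := g) (d := d) t (a + twist t i + twist t (i + 1), false)
            (a, false) (i + 2)
          rw [h21] at h
          rw [skolemThird_comm hg, h, if_pos]
          · simp [h22]
          · have : shift (-twist t (i + 2)) (a, false) =
                (a + twist t i + twist t (i + 1), false) := by
              simp only [shift, Prod.mk.injEq, and_true]
              rw [← sub_eq_zero, ← neg_eq_zero, ← ht]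
              abel
            rw [this, hdd]
        · rw [skolemThird_same, hgd, hs']
      · obtain ⟨-, -, -, -, h12, h21, h12', h22, -⟩ := zmod_three_ne j
        have ht := twist_sum t j
        rw [skolemThird_comm hg t (some ((a, e), j + 1)) (some ((b, e'), j)), skolemThird_up]
        split_ifs with h1 h2
        · obtain ⟨rfl, rfl⟩ := hdx _ _ _ _ _ h1
          simp only at h2
          subst h2
          rw [skolemThird_comm hg, skolemThird_none_false]
          simp
        · obtain ⟨rfl, rfl⟩ := hdx _ _ _ _ _ h1
          simp only [Bool.not_eq_true] at h2
          subst h2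
          rw [← h12, skolemThird_up, if_pos]
          · simp only [Bool.false_eq_true, if_false, Option.some.injEq, Prod.mk.injEq, and_true,
              h12, h12']
            rw [← sub_eq_zero, ← ht]
            abel
          · simp [shift, hdd]
        · set y := d (b, e') (shift (-twist t j) (a, e)) with hy
          -- Commutativity of `g` makes left division by the quotient return the divisor.
          have h3 : d y (shift (-twist t j) (a, e)) = (b, e') := by
            rw [← hgd (b, e') (shift (-twist t j) (a, e)), ← hy, hg, hd]
          rw [skolemThird_comm hg, skolemThird_up, h3, if_neg (Ne.symm h1)]

lemma skolemThird_injective (hg : ∀ x y, g x y = g y x)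
    (hgd : ∀ x z, g x (d x z) = z) (t t' : Y)
    (p r : Option ((Y × Bool) × ZMod 3)) (hpr : p ≠ r)
    (h : skolemThird g d t p r = skolemThird g d t' p r)
    (htw : ∀ i, twist t i = twist t' i → t = t') : t = t' := by
  have shift_inj : ∀ (s s' : Y) x, shift s x = shift s' x → s = s' := fun s s' x h =>
    add_left_cancel (congrArg Prod.fst h)
  have inf : ∀ (x : Y × Bool) (i : ZMod 3), skolemThird g d t none (some (x, i)) =
      skolemThird g d t' none (some (x, i)) → t = t' := by
    rintro ⟨a, _ | _⟩ i h
    · rw [skolemThird_none_false, skolemThird_none_false] at h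
      simp only [Option.some.injEq, Prod.mk.injEq, and_true, sub_right_inj] at h
      exact htw _ h
    · rw [skolemThird_none_true, skolemThird_none_true] at h
      simp only [Option.some.injEq, Prod.mk.injEq, and_true, add_right_inj] at h
      exact htw _ h
  have dinj : ∀ (x z : Y × Bool) (i : ZMod 3),
      d x (shift (-twist t i) z) = d x (shift (-twist t' i) z) → t = t' := by
    intro x z i h
    have h' := congrArg (g x) h
    rw [hgd, hgd] at h'
    exact htw i (neg_injective (shift_inj _ _ _ h'))
  have up : ∀ (x z : Y × Bool) (i : ZMod 3), skolemThird g d t (some (x, i)) (some (z, i + 1)) =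
      skolemThird g d t' (some (x, i)) (some (z, i + 1)) → t = t' := by
    intro x z i h
    rw [skolemThird_up, skolemThird_up] at h
    have hi := (zmod_three_ne i).2.2.2.1
    by_cases h1 : d x (shift (-twist t i) z) = x <;> by_cases h2 : d x (shift (-twist t' i) z) = x
    · exact dinj x z i (h1.trans h2.symm)
    · rw [if_pos h1, if_neg h2] at h
      split_ifs at h
      simp [hi] at h
    · rw [if_neg h1, if_pos h2] at h
      split_ifs at h
      simp only [Option.some.injEq, Prod.mk.injEq] at h
      exact absurd h.2.symm hi
    · rw [if_neg h1, if_neg h2] at h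
      simp only [Option.some.injEq, Prod.mk.injEq, and_true] at h
      exact dinj x z i h
  rcases p with - | ⟨x, i⟩ <;> rcases r with - | ⟨y, j⟩
  · exact absurd rfl hpr
  · exact inf _ _ h
  · rw [skolemThird_comm hg t, skolemThird_comm hg t'] at h
    exact inf _ _ h
  rcases zmod_three_cases i j with rfl | rfl | rfl
  · rw [skolemThird_same, skolemThird_same] at h
    simp only [Option.some.injEq, Prod.mk.injEq, and_true] at h
    exact htw _ (shift_inj _ _ _ h)
  · exact up _ _ _ h
  · rw [skolemThird_comm hg t, skolemThird_comm hg t'] at h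
    exact up _ _ _ h

end Skolem

/-! ### Existence of simple triple designs. -/

lemma twist_injective_of_lt {n l : ℕ} (hl : 2 * l ≤ n) {c c' : ℕ} (hc : c < l) (hc' : c' < l)
    (i : ZMod 3) (h : twist (c : ZMod n) i = twist (c' : ZMod n) i) : c = c' := by
  unfold twist at h
  split_ifs at h
  · have h' := neg_injective h
    have h2 : ((c + c : ℕ) : ZMod n) = ((c' + c' : ℕ) : ZMod n) := by push_cast; exact h'
    rw [ZMod.natCast_eq_natCast_iff', Nat.mod_eq_of_lt (by omega), Nat.mod_eq_of_lt (by omega)] at h2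
    omega
  · rw [ZMod.natCast_eq_natCast_iff', Nat.mod_eq_of_lt (by omega), Nat.mod_eq_of_lt (by omega)] at h
    exact h

lemma exists_disjointTripleSystems_bose {n l : ℕ} (hn : n % 2 = 1) (hl : 2 * l ≤ n) :
    Nonempty (DisjointTripleSystems (Fin l) (ZMod n × ZMod 3)) := by
  have htwo : ((((n + 1) / 2 : ℕ) : ZMod n)) + (((n + 1) / 2 : ℕ) : ZMod n) = 1 := by
    rw [← Nat.cast_add, show (n + 1) / 2 + (n + 1) / 2 = n + 1 by omega]
    simp
  set u : ZMod n := (((n + 1) / 2 : ℕ) : ZMod n)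
  have hh : ∀ y : ZMod n, u * y + u * y = y := fun y => by rw [← add_mul, htwo, one_mul]
  have hdouble : ∀ y z : ZMod n, y + y = z + z → y = z := fun y z h => by
    rw [← hh y, ← hh z, ← mul_add, ← mul_add, h]
  exact ⟨{
    third := fun c => boseThird (fun y => u * y) ((c : ℕ) : ZMod n)
    third_comm := fun c x y _ => boseThird_comm _ _ _
    third_ne := fun c x y h => boseThird_ne _ _ _ h hdouble
    third_third := fun c x y h => boseThird_boseThird hh hdouble _ _ _ h
    disjoint := fun c c' x y _ h => by
      have htw : ∀ i, twist ((c : ℕ) : ZMod n) i = twist ((c' : ℕ) : ZMod n) i → c = c' :=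
        fun i h => Fin.ext (twist_injective_of_lt hl c.2 c'.2 i h)
      have := boseThird_injective hdouble _ _ _ _ h fun i h => by rw [htw i h]
      exact htw 0 (by rw [this]) }⟩

/-- Relabel addition on `ZMod (2 * n)`: read inputs as `a + e * n` and outputs as `2 * a + e`.
Doubling an input kills `e * n` and leaves `2 * a`, the label of `(a, false)`. -/
lemma exists_half_idempotent_quasigroup (n : ℕ) [NeZero n] :
    ∃ g d : ZMod n × Bool → ZMod n × Bool → ZMod n × Bool,
      (∀ x y, g x y = g y x) ∧ (∀ x y, d x (g x y) = y) ∧ (∀ x z, g x (d x z) = z) ∧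
        ∀ a e, g (a, e) (a, e) = (a, false) := by
  have hn : 0 < n := Nat.pos_of_ne_zero (NeZero.ne n)
  have : NeZero (2 * n) := ⟨by omega⟩
  have hcard : Fintype.card (ZMod n × Bool) = Fintype.card (ZMod (2 * n)) := by
    rw [Fintype.card_prod, ZMod.card, ZMod.card, Fintype.card_bool, mul_comm]
  let al : ZMod n × Bool → ZMod (2 * n) := fun x => ((x.1.val + if x.2 then n else 0 : ℕ) : ZMod _)
  let ga : ZMod n × Bool → ZMod (2 * n) := fun x => ((2 * x.1.val + if x.2 then 1 else 0 : ℕ) : ZMod _)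
  have hal : Function.Bijective al := by
    refine (Fintype.bijective_iff_injective_and_card al).2 ⟨?_, hcard⟩
    rintro ⟨a, e⟩ ⟨b, e'⟩ h
    have ha := ZMod.val_lt a
    have hb := ZMod.val_lt b
    simp only [al] at h
    rw [ZMod.natCast_eq_natCast_iff', Nat.mod_eq_of_lt (by split_ifs <;> omega),
      Nat.mod_eq_of_lt (by split_ifs <;> omega)] at h
    have h1 : e = e' := by cases e <;> cases e' <;> simp at h ⊢ <;> omega
    subst h1
    rw [ZMod.val_injective n (Nat.add_right_cancel h)]
  have hga : Function.Bijective ga := by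
    refine (Fintype.bijective_iff_injective_and_card ga).2 ⟨?_, hcard⟩
    rintro ⟨a, e⟩ ⟨b, e'⟩ h
    have ha := ZMod.val_lt a
    have hb := ZMod.val_lt b
    simp only [ga] at h
    rw [ZMod.natCast_eq_natCast_iff', Nat.mod_eq_of_lt (by split_ifs <;> omega),
      Nat.mod_eq_of_lt (by split_ifs <;> omega)] at h
    have h1 : e = e' := by cases e <;> cases e' <;> simp at h ⊢ <;> omega
    subst h1
    rw [ZMod.val_injective n (show a.val = b.val by omega)]
  let α := Equiv.ofBijective al hal
  let γ := Equiv.ofBijective ga hga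
  have hαγ : ∀ a e, α (a, e) + α (a, e) = γ (a, false) := by
    intro a e
    change al (a, e) + al (a, e) = ga (a, false)
    simp only [al, ga]
    rw [← Nat.cast_add, ZMod.natCast_eq_natCast_iff']
    cases e
    · simp [two_mul]
    · simp only [if_true, Bool.false_eq_true, if_false, add_zero]
      rw [show a.val + n + (a.val + n) = 2 * a.val + 2 * n by ring, Nat.add_mod_right]
  refine ⟨fun x y => γ.symm (α x + α y), fun x z => α.symm (γ z - α x), ?_, ?_, ?_, ?_⟩
  · exact fun x y => congrArg γ.symm (add_comm _ _)
  · intro x y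
    simp
  · intro x z
    simp
  · intro a e
    simp only [hαγ, Equiv.symm_apply_apply]

lemma exists_disjointTripleSystems_skolem {n l : ℕ} [NeZero n] (hl : 2 * l ≤ n) :
    Nonempty (DisjointTripleSystems (Fin l) (Option ((ZMod n × Bool) × ZMod 3))) := by
  obtain ⟨g, d, hg, hd, hgd, hgg⟩ := exists_half_idempotent_quasigroup n
  exact ⟨{
    third := fun c => skolemThird g d ((c : ℕ) : ZMod n)
    third_comm := fun c x y _ => skolemThird_comm hg _ _ _
    third_ne := fun c x y h => skolemThird_ne hg _ _ _ h
    third_third := fun c x y h => skolemThird_skolemThird hg hd hgd hgg _ _ _ h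
    disjoint := fun c c' x y hxy h => by
      have htw : ∀ i, twist ((c : ℕ) : ZMod n) i = twist ((c' : ℕ) : ZMod n) i → c = c' :=
        fun i h => Fin.ext (twist_injective_of_lt hl c.2 c'.2 i h)
      have := skolemThird_injective hg hgd _ _ _ _ hxy h fun i h => by rw [htw i h]
      exact htw 0 (by rw [this]) }⟩

/-- Simple 2-designs with block size 3 exist for all `v ≡ 1, 3 (mod 6)` that are large in terms of
the index. -/
theorem exists_simple_triple_design {v l : ℕ} (hv : v % 6 = 1 ∨ v % 6 = 3)
    (hl : 12 * l + 1 < v) :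
    ∃ B : Finset (Finset (Fin v)), (∀ b ∈ B, b.card = 3) ∧
      ∀ i j, i ≠ j → (B.filter fun b => i ∈ b ∧ j ∈ b).card = l := by
  have : Nonempty (DisjointTripleSystems (Fin l) (Fin v)) := by
    rcases hv with hv | hv
    · have : NeZero (v / 6) := ⟨by omega⟩
      obtain ⟨D⟩ := exists_disjointTripleSystems_skolem (n := v / 6) (l := l) (by omega)
      exact ⟨D.congr (Fintype.equivFinOfCardEq (by
        simp only [Fintype.card_option, Fintype.card_prod, ZMod.card, Fintype.card_bool]
        omega))⟩
    · have : NeZero (v / 3) := ⟨by omega⟩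
      obtain ⟨D⟩ := exists_disjointTripleSystems_bose (n := v / 3) (l := l) (by omega) (by omega)
      exact ⟨D.congr (Fintype.equivFinOfCardEq (by
        simp only [Fintype.card_prod, ZMod.card]
        omega))⟩
  obtain ⟨D⟩ := this
  simpa using DisjointTripleSystems.exists_triples D

end Designs

end ForbConfig
namespace ForbConfig

/-! ### Translation between matrices and set systems. -/

section Matrices

open Finset

variable {m n q : ℕ}

lemma mem_supp {α : Fin m → Fin 2} {i : Fin m} : i ∈ supp α ↔ α i = 1 := by simp [supp]

lemma notMem_supp {α : Fin m → Fin 2} {i : Fin m} : i ∉ supp α ↔ α i = 0 := by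
  rw [mem_supp]
  generalize α i = x
  revert x; decide

lemma colSum_eq_card_supp (α : Fin m → Fin 2) : colSum α = (supp α).card := by
  rw [colSum, supp, card_filter]
  refine sum_congr rfl fun i _ => ?_
  generalize α i = x
  revert x; decide

lemma supp_injective : Function.Injective (supp (m := m)) := by
  intro α β h
  funext i
  have hi : i ∈ supp α ↔ i ∈ supp β := by rw [h]
  rw [mem_supp, mem_supp] at hi
  revert hi
  generalize α i = x
  generalize β i = y
  revert x y; decide

/-- The column with a given support. -/
def indicator (T : Finset (Fin m)) : Fin m → Fin 2 := fun i => if i ∈ T then 1 else 0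

lemma supp_indicator (T : Finset (Fin m)) : supp (indicator T) = T := by
  ext i; simp [mem_supp, indicator]

/-- The set system of the supports of the columns of a matrix. -/
def columnSystem (A : ZOMatrix m n) (j : Fin n) : Finset (Fin m) := supp (column A j)

lemma colSum_column (A : ZOMatrix m n) (j : Fin n) :
    colSum (column A j) = (columnSystem A j).card := colSum_eq_card_supp _

lemma card_triples (A : ZOMatrix m n) :
    (triples A).card = (univ.filter fun c => (columnSystem A c).card = 3).card := by
  rw [triples, Multiset.card_map, card_val]
  simp only [colSum_column]

/-- The first two rows of a copy of the configuration form the pair, and the third is the point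
missed by the `q` chosen columns. -/
lemma fewSeparating_columnSystem_iff (A : ZOMatrix m n) :
    FewSeparating q (columnSystem A) ↔ ¬ HasConfig A (copies q 2 1) := by
  constructor
  · rintro h ⟨r, c, hrc⟩
    have hA : ∀ i j, A (r i) (c j) = if (i : ℕ) < 2 then 1 else 0 := fun i j =>
      congrFun (congrFun hrc i) j
    have h01 : r 0 ≠ r 1 := r.injective.ne (by decide)
    have h02 : r 2 ≠ r 0 := r.injective.ne (by decide)
    have h12 : r 2 ≠ r 1 := r.injective.ne (by decide)
    have hlt := h {r 0, r 1} (card_pair h01) (r 2) (by simp [h02, h12])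
    have hsub : univ.map c ⊆
        univ.filter fun j => {r 0, r 1} ⊆ columnSystem A j ∧ r 2 ∉ columnSystem A j := by
      intro x hx
      obtain ⟨j, -, rfl⟩ := mem_map.1 hx
      simp only [mem_filter, mem_univ, true_and, insert_subset_iff, singleton_subset_iff,
        columnSystem, mem_supp, column]
      exact ⟨⟨hA 0 j, hA 1 j⟩, by rw [hA 2 j]; decide⟩
    have := card_le_card hsub
    rw [card_map, card_univ, Fintype.card_fin] at this
    omega
  · intro h p hp k hk
    by_contra! hcon
    apply h
    obtain ⟨a, b, hab, rfl⟩ := card_eq_two.1 hp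
    simp only [mem_insert, mem_singleton, not_or] at hk
    obtain ⟨T, hT, hTq⟩ := exists_subset_card_eq hcon
    have hmem : ∀ j ∈ T, A a j = 1 ∧ A b j = 1 ∧ A k j = 0 := by
      intro j hj
      have := (mem_filter.1 (hT hj)).2
      simp only [insert_subset_iff, singleton_subset_iff, columnSystem, mem_supp,
        column] at this
      exact ⟨this.1.1, this.1.2, notMem_supp.1 (mt mem_supp.1 this.2)⟩
    have hinj : Function.Injective (![a, b, k] : Fin 3 → Fin m) := by
      intro x y
      fin_cases x <;> fin_cases y <;> simp [hab, hab.symm, hk.1, hk.2, Ne.symm hk.1, Ne.symm hk.2]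
    refine ⟨⟨![a, b, k], hinj⟩,
      (T.equivFinOfCardEq hTq).symm.toEmbedding.trans (Function.Embedding.subtype _), ?_⟩
    ext i j
    obtain ⟨h1, h2, h3⟩ := hmem _ ((T.equivFinOfCardEq hTq).symm j).2
    fin_cases i <;> simp [copies, h1, h2, h3]

lemma noRepeats_columnSystem_iff (A : ZOMatrix m n) :
    NoRepeats (columnSystem A) ↔ NoRepeatedSmallOrFull A := by
  simp only [NoRepeats, NoRepeatedSmallOrFull, columnSystem, colSum_eq_card_supp,
    Fintype.card_fin, Set.mem_insert_iff, Set.mem_singleton_iff, supp_injective.eq_iff]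

lemma forall_existsUnique_column_iff (A : ZOMatrix m n) :
    (∀ α : Fin m → Fin 2, colSum α ∈ ({0, 1, 2, m} : Set ℕ) → ∃! j, column A j = α) ↔
      NoRepeats (columnSystem A) ∧
        ∀ T : Finset (Fin m), (T.card = 0 ∨ T.card = 1 ∨ T.card = 2 ∨ T.card = Fintype.card (Fin m)) →
          ∃ c, columnSystem A c = T := by
  simp only [colSum_eq_card_supp, Set.mem_insert_iff, Set.mem_singleton_iff]
  constructor
  · intro h
    refine ⟨fun c c' hc hcc => ?_, fun T hT => ?_⟩
    · rw [Fintype.card_fin] at hc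
      exact (h _ hc).unique rfl (supp_injective hcc.symm)
    · rw [Fintype.card_fin] at hT
      obtain ⟨j, hj, -⟩ := h (indicator T) (by rwa [supp_indicator])
      exact ⟨j, by rw [columnSystem, hj, supp_indicator]⟩
  · rintro ⟨h1, h2⟩ α hα
    obtain ⟨j, hj⟩ := h2 (supp α) (by rwa [Fintype.card_fin])
    refine ⟨j, supp_injective hj, fun j' hj' => h1 _ _ ?_ ?_⟩
    · simpa only [columnSystem, hj', Fintype.card_fin] using hα
    · rw [hj, columnSystem, hj']

lemma countP_triples (A : ZOMatrix m n) (P : Finset (Fin m) → Prop) [DecidablePred P] :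
    (triples A).countP P =
      (univ.filter fun c => P (columnSystem A c) ∧ (columnSystem A c).card = 3).card := by
  rw [triples, Multiset.countP_map, ← filter_val, card_val, filter_filter]
  simp only [colSum_column, and_comm]
  rfl

/-- Double count incidences between triples and pairs; so the size clause of `IsTripleSystem`
follows from the pair clause. -/
lemma three_mul_card_triples (A : ZOMatrix m n) {l : ℕ}
    (h : ∀ i j : Fin m, i ≠ j → (triples A).countP (fun b => i ∈ b ∧ j ∈ b) = l) :
    3 * (triples A).card = l * m.choose 2 := by
  set I := univ.filter fun c => (columnSystem A c).card = 3 with hI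
  have hcard : (triples A).card = I.card := card_triples A
  have hdc := sum_card_bipartiteAbove_eq_sum_card_bipartiteBelow
    (s := I) (t := powersetCard 2 (univ : Finset (Fin m)))
    (fun c p => p ⊆ columnSystem A c)
  rw [hcard, mul_comm 3, mul_comm l]
  have e1 : ∀ c ∈ I, (bipartiteAbove (fun c p => p ⊆ columnSystem A c)
      (powersetCard 2 (univ : Finset (Fin m))) c).card = 3 := by
    intro c hc
    have : bipartiteAbove (fun c p => p ⊆ columnSystem A c)
        (powersetCard 2 (univ : Finset (Fin m))) c = powersetCard 2 (columnSystem A c) := by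
      ext p
      simp only [bipartiteAbove, mem_filter, mem_powersetCard, subset_univ, true_and]
      tauto
    rw [this, card_powersetCard, (mem_filter.1 hc).2]
    rfl
  have e2 : ∀ p ∈ powersetCard 2 (univ : Finset (Fin m)),
      (bipartiteBelow (fun c p => p ⊆ columnSystem A c) I p).card = l := by
    intro p hp
    obtain ⟨i, j, hij, rfl⟩ := card_eq_two.1 (mem_powersetCard.1 hp).2
    rw [← h i j hij, countP_triples]
    congr 1
    ext c
    simp only [bipartiteBelow, hI, mem_filter, mem_univ, true_and, insert_subset_iff,
      singleton_subset_iff]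
    tauto
  rw [sum_const_nat e1, sum_const_nat e2, card_powersetCard, card_univ, Fintype.card_fin] at hdc
  exact hdc

lemma pairs_iff_countP (A : ZOMatrix m n) (l : ℕ) :
    (∀ p : Finset (Fin m), p.card = 2 →
      (univ.filter fun c => p ⊆ columnSystem A c ∧ (columnSystem A c).card = 3).card = l) ↔
    ∀ i j : Fin m, i ≠ j → (triples A).countP (fun b => i ∈ b ∧ j ∈ b) = l := by
  have key : ∀ i j : Fin m, (triples A).countP (fun b => i ∈ b ∧ j ∈ b) =
      (univ.filter fun c => {i, j} ⊆ columnSystem A c ∧ (columnSystem A c).card = 3).card := by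
    intro i j
    simp only [countP_triples, insert_subset_iff, singleton_subset_iff]
  constructor
  · intro h i j hij
    rw [key, h _ (card_pair hij)]
  · intro h p hp
    obtain ⟨i, j, hij, rfl⟩ := card_eq_two.1 hp
    rw [← key, h i j hij]

lemma isTripleSystem_triples_iff (A : ZOMatrix m n) (l : ℕ) :
    IsTripleSystem m l (triples A) ↔
      ∀ p : Finset (Fin m), p.card = 2 →
        (univ.filter fun c => p ⊆ columnSystem A c ∧ (columnSystem A c).card = 3).card = l := by
  rw [pairs_iff_countP]
  refine ⟨fun h => h.2.2, fun h => ⟨fun b hb => ?_, three_mul_card_triples A h, h⟩⟩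
  obtain ⟨j, hj, rfl⟩ := Multiset.mem_map.1 hb
  rw [← colSum_eq_card_supp]
  rw [mem_val] at hj
  exact (mem_filter.1 hj).2

/-- The full column misses no point, so only `p` itself and its `q - 2` triples can separate `p`
from `k`. -/
lemma ConsistsOfDesign.fewSeparating {A : ZOMatrix m n} (hq : 2 < q)
    (h : ConsistsOfDesign (q - 2) A) : FewSeparating q (columnSystem A) := by
  obtain ⟨h1, h2, h3⟩ := h
  rw [forall_existsUnique_column_iff] at h1
  rw [isTripleSystem_triples_iff] at h2
  intro p hp k hk
  obtain ⟨c₂, hc₂⟩ := h1.2 p (by simp [hp])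
  have hsub : (univ.filter fun c => p ⊆ columnSystem A c ∧ k ∉ columnSystem A c) ⊆
      insert c₂ (univ.filter fun c => p ⊆ columnSystem A c ∧ (columnSystem A c).card = 3) := by
    intro c hc
    simp only [mem_filter, mem_univ, true_and] at hc
    simp only [mem_insert, mem_filter, mem_univ, true_and]
    have h2c : 2 ≤ (columnSystem A c).card := hp ▸ card_le_card hc.1
    have hcase := h3 c
    simp only [colSum_column, Set.mem_insert_iff, Set.mem_singleton_iff] at hcase
    rcases hcase with e | e | e | e | e
    · omega
    · omega
    · left
      refine h1.1 c c₂ (by simp [e]) ?_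
      rw [hc₂]
      exact (eq_of_subset_of_card_le hc.1 (by omega)).symm
    · exact Or.inr ⟨hc.1, e⟩
    · refine absurd ?_ hc.2
      rw [(card_eq_iff_eq_univ _).1 (e.trans (Fintype.card_fin m).symm)]
      exact mem_univ k
  have := (card_le_card hsub).trans (card_insert_le _ _)
  rw [h2 p hp] at this
  omega

lemma card_filter_card_eq {S : Fin n → Finset (Fin m)} (hS : NoRepeats S)
    (hsurj : ∀ T : Finset (Fin m), (T.card = 0 ∨ T.card = 1 ∨ T.card = 2 ∨
      T.card = Fintype.card (Fin m)) → ∃ c, S c = T) {t : ℕ}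
    (ht : t = 0 ∨ t = 1 ∨ t = 2 ∨ t = Fintype.card (Fin m)) :
    (univ.filter fun c => (S c).card = t).card = m.choose t := by
  have hinj : Set.InjOn S (univ.filter fun c => (S c).card = t) := fun c hc c' _ e =>
    hS c c' (by rw [(by simpa using hc : (S c).card = t)]; exact ht) e
  rw [← card_image_of_injOn hinj]
  trans (powersetCard t (univ : Finset (Fin m))).card
  · congr 1
    ext T
    simp only [mem_image, mem_filter, mem_univ, true_and, mem_powersetCard, subset_univ]
    constructor
    · rintro ⟨c, hc, rfl⟩; exact hc
    · intro hT
      obtain ⟨c, rfl⟩ := hsurj T (hT ▸ ht)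
      exact ⟨c, hT, rfl⟩
  · rw [card_powersetCard, card_univ, Fintype.card_fin]

lemma ConsistsOfDesign.card_eq {A : ZOMatrix m n} (hq : 2 < q) (hm : 3 < m)
    (h : ConsistsOfDesign (q - 2) A) :
    (n : ℝ) = (m : ℝ) + 2 + ((q : ℝ) + 1) / 3 * (m.choose 2 : ℝ) := by
  obtain ⟨h1, h2, h3⟩ := h
  rw [forall_existsUnique_column_iff] at h1
  have hb := h2.2.1
  have hsplit : n = (univ.filter fun c => (columnSystem A c).card = 0).card +
      (univ.filter fun c => (columnSystem A c).card = 1).card +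
      (univ.filter fun c => (columnSystem A c).card = 2).card +
      (univ.filter fun c => (columnSystem A c).card = 3).card +
      (univ.filter fun c => (columnSystem A c).card = m).card := by
    trans (univ : Finset (Fin n)).card
    · simp
    rw [card_eq_sum_ones]
    simp only [card_filter]
    rw [← sum_add_distrib, ← sum_add_distrib, ← sum_add_distrib, ← sum_add_distrib]
    refine sum_congr rfl fun c _ => ?_
    have hcase := h3 c
    simp only [colSum_column, Set.mem_insert_iff, Set.mem_singleton_iff] at hcase
    -- Since `3 < m`, the five sizes are distinct and each column is counted once.
    split_ifs <;> omega
  rw [card_filter_card_eq h1.1 h1.2 (t := 0) (by simp),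
    card_filter_card_eq h1.1 h1.2 (t := 1) (by simp),
    card_filter_card_eq h1.1 h1.2 (t := 2) (by simp),
    card_filter_card_eq h1.1 h1.2 (t := m) (by simp), ← card_triples,
    Nat.choose_zero_right, Nat.choose_one_right, Nat.choose_self] at hsplit
  have e1 : (n : ℝ) = 1 + m + m.choose 2 + (triples A).card + 1 := by exact_mod_cast hsplit
  have e2 : 3 * ((triples A).card : ℝ) = ((q : ℝ) - 2) * m.choose 2 := by
    rw [← Nat.cast_two (R := ℝ), ← Nat.cast_sub hq.le]
    exact_mod_cast hb
  linarith

lemma bound_and_extremal (hq : 2 < q) (hm : 60 * q ^ 5 < m) (A : ZOMatrix m n)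
    (h1 : NoRepeatedSmallOrFull A) (h2 : ¬ HasConfig A (copies q 2 1)) :
    (n : ℝ) ≤ (m : ℝ) + 2 + ((q : ℝ) + 1) / 3 * (m.choose 2 : ℝ) ∧
      ((n : ℝ) = (m : ℝ) + 2 + ((q : ℝ) + 1) / 3 * (m.choose 2 : ℝ) →
        ConsistsOfDesign (q - 2) A) := by
  have hS := (noRepeats_columnSystem_iff A).2 h1
  have key := card_le_of_fewSeparating ((fewSeparating_columnSystem_iff A).2 h2) hS hq
    (by rwa [Fintype.card_fin])
  simp only [Fintype.card_fin] at key
  refine ⟨key.1, fun e => ?_⟩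
  obtain ⟨k1, k2, k3⟩ := key.2 e
  refine ⟨(forall_existsUnique_column_iff A).2 ⟨hS, by simpa only [Fintype.card_fin] using k1⟩,
    (isTripleSystem_triples_iff A _).2 k2, fun j => ?_⟩
  simpa only [colSum_column, Set.mem_insert_iff, Set.mem_singleton_iff] using k3 j

lemma exists_simple_consistsOfDesign {l : ℕ} (hm : m % 6 = 1 ∨ m % 6 = 3)
    (hl : 12 * l + 1 < m) (hm3 : 3 < m) :
    ∃ (n : ℕ) (A : ZOMatrix m n), IsSimple A ∧ ConsistsOfDesign l A := by
  obtain ⟨B, hB3, hB⟩ := exists_simple_triple_design hm hl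
  -- A set of supports, without multiplicity, yields a simple matrix; this is why `B` must have
  -- distinct triples.
  set F : Finset (Finset (Fin m)) := univ.filter fun T =>
    T.card = 0 ∨ T.card = 1 ∨ T.card = 2 ∨ T.card = m ∨ T ∈ B with hF
  let e := F.equivFin
  let A : ZOMatrix m F.card := Matrix.of fun i j => indicator (e.symm j : Finset (Fin m)) i
  have hA : ∀ j, columnSystem A j = e.symm j := fun j => supp_indicator _
  have hinj : Function.Injective (columnSystem A) := fun j j' h => by
    rw [hA, hA] at h
    exact e.symm.injective (Subtype.ext h)
  have hsurj : ∀ T ∈ F, ∃ c, columnSystem A c = T := fun T hT =>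
    ⟨e ⟨T, hT⟩, by rw [hA, Equiv.symm_apply_apply]⟩
  have hmem : ∀ c, columnSystem A c ∈ F := fun c => by rw [hA]; exact (e.symm c).2
  refine ⟨F.card, A, fun j j' h => hinj (congrArg supp h), ?_, ?_, fun j => ?_⟩
  · refine (forall_existsUnique_column_iff A).2 ⟨fun c c' _ h => hinj h, fun T hT => hsurj T ?_⟩
    rw [Fintype.card_fin] at hT
    simp only [hF, mem_filter, mem_univ, true_and]
    tauto
  · refine (isTripleSystem_triples_iff A l).2 ((pairs_iff_countP A l).2 fun i j hij => ?_)
    rw [countP_triples, ← hB i j hij, ← card_image_of_injective _ hinj]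
    congr 1
    ext T
    simp only [mem_image, mem_filter, mem_univ, true_and]
    constructor
    · rintro ⟨c, ⟨hc, hc3⟩, rfl⟩
      have := hmem c
      simp only [hF, mem_filter, mem_univ, true_and] at this
      refine ⟨?_, hc⟩
      rcases this with h | h | h | h | h
      · omega
      · omega
      · omega
      · omega
      · exact h
    · rintro ⟨hT, hij⟩
      obtain ⟨c, rfl⟩ := hsurj T (by simp [hF, hT])
      exact ⟨c, ⟨hij, hB3 _ hT⟩, rfl⟩
  · have := hmem j
    simp only [hF, mem_filter, mem_univ, true_and] at this
    simp only [colSum_column, Set.mem_insert_iff, Set.mem_singleton_iff]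
    rcases this with h | h | h | h | h
    · simp [h]
    · simp [h]
    · simp [h]
    · simp [h]
    · simp [hB3 _ h]

lemma IsSimple.noRepeatedSmallOrFull {A : ZOMatrix m n} (h : IsSimple A) :
    NoRepeatedSmallOrFull A := fun _ _ _ e => h e

end Matrices

end ForbConfig

theorem proposition6 (q : ℕ) (hq : 2 < q) :
    ∃ M : ℕ, ∀ m : ℕ, M < m →
      (∀ (n : ℕ) (A : ForbConfig.ZOMatrix m n),
        ForbConfig.NoRepeatedSmallOrFull A →
        ¬ ForbConfig.HasConfig A (ForbConfig.copies q 2 1) →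
          (n : ℝ) ≤ (m : ℝ) + 2 + ((q : ℝ) + 1) / 3 * (m.choose 2 : ℝ)) ∧
      (m % 6 = 1 ∨ m % 6 = 3 →
        (∃ (n : ℕ) (A : ForbConfig.ZOMatrix m n),
          ForbConfig.NoRepeatedSmallOrFull A ∧
          ¬ ForbConfig.HasConfig A (ForbConfig.copies q 2 1) ∧
          (n : ℝ) = (m : ℝ) + 2 + ((q : ℝ) + 1) / 3 * (m.choose 2 : ℝ)) ∧
        ((ForbConfig.forb m (ForbConfig.copies q 2 1) : ℝ) =
          (m : ℝ) + 2 + ((q : ℝ) + 1) / 3 * (m.choose 2 : ℝ)) ∧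
        ∀ (n : ℕ) (A : ForbConfig.ZOMatrix m n),
          (ForbConfig.NoRepeatedSmallOrFull A ∧
            ¬ ForbConfig.HasConfig A (ForbConfig.copies q 2 1) ∧
            n = ForbConfig.forb m (ForbConfig.copies q 2 1)) ↔
          ForbConfig.ConsistsOfDesign (q - 2) A) := by
  open ForbConfig in
  refine ⟨60 * q ^ 5, fun m hm => ⟨fun n A h1 h2 => (bound_and_extremal hq hm A h1 h2).1,
    fun hmod => ?_⟩⟩
  have hq5 : q ≤ q ^ 5 := Nat.le_self_pow (by norm_num) q
  have hm3 : 3 < m := by omega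
  obtain ⟨n₀, A₀, hA₀, hD₀⟩ := exists_simple_consistsOfDesign (l := q - 2) hmod (by omega) hm3
  have hn₀ := hD₀.card_eq hq hm3
  have hF₀ : ¬ HasConfig A₀ (copies q 2 1) :=
    (fewSeparating_columnSystem_iff A₀).1 (hD₀.fewSeparating hq)
  have hforb : forb m (copies q 2 1) = n₀ := by
    -- That `n₀` is an upper bound is used twice: for `forb ≤ n₀`, and for nonemptiness of the set
    -- whose infimum defines `forb`. The matrix `A₀` gives the reverse inequality.
    refine le_antisymm (Nat.sInf_le fun n A h1 h2 => ?_) (le_csInf ⟨n₀, fun n A h1 h2 => ?_⟩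
      fun N hN => hN n₀ A₀ hA₀ hF₀)
    all_goals
      have := (bound_and_extremal hq hm A h1.noRepeatedSmallOrFull h2).1
      rw [← hn₀] at this
      exact_mod_cast this
  refine ⟨⟨n₀, A₀, hA₀.noRepeatedSmallOrFull, hF₀, hn₀⟩, by rw [hforb, hn₀], fun n A => ?_⟩
  rw [hforb]
  constructor
  · rintro ⟨h1, h2, rfl⟩
    exact (bound_and_extremal hq hm A h1 h2).2 hn₀
  · intro h
    refine ⟨(noRepeats_columnSystem_iff A).1 ((forall_existsUnique_column_iff A).1 h.1).1,
      (fewSeparating_columnSystem_iff A).1 (h.fewSeparating hq), ?_⟩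
    have := h.card_eq hq hm3
    rw [← hn₀] at this
    exact_mod_cast this
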